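/- Let $k$ be a field, let $Q$ be a finite quiver, let $J$ be the ideal of the path algebra $kQ$ generated by all arrows, and put $\Lambda = kQ/J^2$. A differential projective $\Lambda$-module is a pair $(M,d)$ where $M$ is a (not necessarily finitely generated) projective left $\Lambda$-module and $d\colon M\to M$ is a $\Lambda$-linear map with $d^2=0$; morphisms are the $\Lambda$-linear maps commuting with the differentials. A $\Lambda$-linear map $f\colon (M,d)\to (N,\delta)$ is null homotopic if $f = rd+\delta r$ for some $\Lambda$-linear map $r\colon M\to N$. A differential projective module is contractible if its identity map is null homotopic, and reduced if it has no nonzero contractible direct summand. Every differential projective module $M$ has a decomposition $M\cong M'\oplus M''$ with $M'$ contractible and $M''$ reduced, unique up to isomorphism; $M''$ is called the reduced part of $M$. Let $\mathcal T$ be the homotopy category of differential projective $\Lambda$-modules: its objects are the differential projective $\Lambda$-modules, and its morphisms are the morphisms of differential modules modulo the null homotopic ones. An object $S$ of $\mathcal T$ is compact if for every set-indexed family $(T_\lambda)_{\lambda\in L}$ of objects of $\mathcal T$ the natural monomorphism $\coprod_{\lambda} \mathrm{Hom}_{\mathcal T}(S,T_\lambda)\to \mathrm{Hom}_{\mathcal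 T}(S,\coprod_\lambda T_\lambda)$ is an epimorphism. Let $\mathcal T^{c}$ be the full subcategory of compact objects of $\mathcal T$, and let $\mathcal T^{fd}$ be the full subcategory of the objects $M$ whose reduced part $M''$ is finite dimensional over $k$. Then $\mathcal T^{fd}\subseteq \mathcal T^{c}$. Moreover, the equality $\mathcal T^{fd}=\mathcal T^{c}$ holds if and only if $Q$ is acyclic, i.e. has no oriented cycles. -/

import Mathlib

open CategoryTheory CategoryTheory.Limits
open scoped DirectSum

universe w u

noncomputable section

/-! ### Quivers and path algebras -/

/-- All paths of a quiver, including the trivial ones. -/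
abbrev QuiverPaths (V : Type u) [Quiver.{u} V] : Type u :=
  Σ a b : V, Quiver.Path a b

/-- A quiver is acyclic if it has no oriented cycles, i.e. no paths of positive length
that start and end at the same vertex. -/
def QuiverAcyclic (V : Type u) [Quiver.{u} V] : Prop :=
  ∀ (a : V) (p : Quiver.Path a a), p.length = 0

/-- The path algebra `kQ`: its underlying vector space has the set of all paths as a basis. -/
def PathAlgebra (k : Type u) [Field k] (V : Type u) [Quiver.{u} V] : Type u :=
  QuiverPaths V →₀ k

namespace PathAlgebra

variable (k : Type u) [Field k] {V : Type u} [Quiver.{u} V]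

instance : AddCommGroup (PathAlgebra k V) :=
  inferInstanceAs (AddCommGroup (QuiverPaths V →₀ k))

instance : Module k (PathAlgebra k V) :=
  inferInstanceAs (Module k (QuiverPaths V →₀ k))

/-- The basis element given by a path. -/
def ofPath {a b : V} (p : Quiver.Path a b) : PathAlgebra k V :=
  Finsupp.single (⟨a, b, p⟩ : QuiverPaths V) (1 : k)

open scoped Classical in
/-- The product `p q` of two paths is the path "first `q`, then `p`" if `q` ends where `p` starts,
and it is zero otherwise. -/
def pathMul (p q : QuiverPaths V) : PathAlgebra k V :=
  if h : q.2.1 = p.1 then ofPath k (q.2.2.comp (p.2.2.cast h.symm rfl)) else 0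

/-- The multiplication of the path algebra, the bilinear extension of the product of paths. -/
def mulLin : PathAlgebra k V →ₗ[k] PathAlgebra k V →ₗ[k] PathAlgebra k V :=
  Finsupp.linearCombination k fun p : QuiverPaths V =>
    (Finsupp.linearCombination k fun q : QuiverPaths V => pathMul k p q :
      (QuiverPaths V →₀ k) →ₗ[k] PathAlgebra k V)

instance : Mul (PathAlgebra k V) := ⟨fun x y => mulLin k x y⟩

/-- The unit element is the sum of the trivial paths. -/
instance [Fintype V] : One (PathAlgebra k V) :=
  ⟨∑ a : V, ofPath k (Quiver.Path.nil : Quiver.Path a a)⟩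

variable {k}

theorem mul_def (x y : PathAlgebra k V) : x * y = mulLin k x y := rfl

theorem one_def [Fintype V] :
    (1 : PathAlgebra k V) = ∑ a : V, ofPath k (Quiver.Path.nil : Quiver.Path a a) := rfl

theorem mulLin_ofPath {a b c d : V} (p : Quiver.Path a b) (q : Quiver.Path c d) :
    mulLin k (ofPath k p) (ofPath k q) = pathMul k ⟨a, b, p⟩ ⟨c, d, q⟩ := by
  unfold mulLin
  conv_lhs => unfold ofPath
  erw [Finsupp.linearCombination_single, one_smul, Finsupp.linearCombination_single, one_smul]

theorem ofPath_mul_ofPath {a b c : V} (p : Quiver.Path b c) (q : Quiver.Path a b) :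
    ofPath k p * ofPath k q = ofPath k (q.comp p) := by
  rw [mul_def, mulLin_ofPath, pathMul, dif_pos rfl]
  rfl

theorem ofPath_mul_ofPath_of_ne {a b c d : V} (p : Quiver.Path a b) (q : Quiver.Path c d)
    (h : d ≠ a) : ofPath k p * ofPath k q = 0 := by
  rw [mul_def, mulLin_ofPath, pathMul, dif_neg h]

theorem induction_on {P : PathAlgebra k V → Prop} (x : PathAlgebra k V) (zero : P 0)
    (add : ∀ x y, P x → P y → P (x + y)) (smul : ∀ (c : k) x, P x → P (c • x))
    (path : ∀ {a b : V} (p : Quiver.Path a b), P (ofPath k p)) : P x := by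
  refine Finsupp.induction_linear (motive := P) x zero add ?_
  rintro ⟨a, b, p⟩ c
  have := smul c _ (path p)
  have h : c • ofPath k p = Finsupp.single (⟨a, b, p⟩ : QuiverPaths V) c := by
    unfold ofPath
    erw [Finsupp.smul_single, smul_eq_mul, mul_one]
  rwa [h] at this

instance [Fintype V] : Ring (PathAlgebra k V) where
  __ := (inferInstance : AddCommGroup (PathAlgebra k V))
  left_distrib x y z := map_add _ _ _
  right_distrib x y z := by simp only [mul_def, map_add, LinearMap.add_apply]
  zero_mul x := by simp only [mul_def, map_zero, LinearMap.zero_apply]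
  mul_zero x := by simp only [mul_def, map_zero]
  mul_assoc x y z := by
    simp only [mul_def]
    induction x using induction_on with
    | zero => simp only [map_zero, LinearMap.zero_apply]
    | add x x' h h' => simp only [map_add, LinearMap.add_apply, h, h']
    | smul c x h => simp only [map_smul, LinearMap.smul_apply, h]
    | path p =>
      induction y using induction_on with
      | zero => simp only [map_zero, LinearMap.zero_apply]
      | add x x' h h' => simp only [map_add, LinearMap.add_apply, h, h']
      | smul c x h => simp only [map_smul, LinearMap.smul_apply, h]
      | path q =>
        induction z using induction_on with
        | zero => simp only [map_zero]
        | add x x' h h' => simp only [map_add, h, h']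
        | smul c x h => simp only [map_smul, h]
        | path r =>
          simp only [← mul_def]
          rename_i a b c d e f
          have zm : ∀ x : PathAlgebra k V, 0 * x = 0 := fun x => by
            simp only [mul_def, map_zero, LinearMap.zero_apply]
          have mz : ∀ x : PathAlgebra k V, x * 0 = 0 := fun x => by
            simp only [mul_def, map_zero]
          by_cases h1 : d = a
          · subst h1
            by_cases h2 : f = c
            · subst h2
              simp only [ofPath_mul_ofPath, Quiver.Path.comp_assoc]
            · rw [ofPath_mul_ofPath, ofPath_mul_ofPath_of_ne _ _ h2,
                ofPath_mul_ofPath_of_ne _ _ h2, mz]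
          · by_cases h2 : f = c
            · subst h2
              rw [ofPath_mul_ofPath, ofPath_mul_ofPath_of_ne _ _ h1,
                ofPath_mul_ofPath_of_ne _ _ h1, zm]
            · rw [ofPath_mul_ofPath_of_ne _ _ h1, ofPath_mul_ofPath_of_ne _ _ h2, zm, mz]
  one_mul x := by
    rw [mul_def]
    induction x using induction_on with
    | zero => simp only [map_zero]
    | add x x' h h' => simp only [map_add, h, h']
    | smul c x h => simp only [map_smul, h]
    | path p =>
      rename_i a b
      rw [one_def, map_sum, LinearMap.sum_apply, Finset.sum_eq_single b]
      · exact ofPath_mul_ofPath _ _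
      · intro c _ hc
        exact ofPath_mul_ofPath_of_ne _ _ hc.symm
      · intro h
        exact absurd (Finset.mem_univ _) h
  mul_one x := by
    rw [mul_def]
    induction x using induction_on with
    | zero => simp only [map_zero, LinearMap.zero_apply]
    | add x x' h h' => simp only [map_add, LinearMap.add_apply, h, h']
    | smul c x h => simp only [map_smul, LinearMap.smul_apply, h]
    | path p =>
      rename_i a b
      rw [one_def, map_sum, Finset.sum_eq_single a]
      · exact (ofPath_mul_ofPath _ _).trans (by rw [Quiver.Path.nil_comp])
      · intro c _ hc
        exact ofPath_mul_ofPath_of_ne _ _ hc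
      · intro h
        exact absurd (Finset.mem_univ _) h

instance [Fintype V] : Algebra k (PathAlgebra k V) :=
  Algebra.ofModule
    (fun c x y => by simp only [mul_def, map_smul, LinearMap.smul_apply])
    (fun c x y => by simp only [mul_def, map_smul])

variable (k V)

/-- The arrow ideal `J` of `kQ`: the two-sided ideal generated by all arrows. -/
def arrowIdeal [Fintype V] : Ideal (PathAlgebra k V) :=
  (TwoSidedIdeal.span
    {x : PathAlgebra k V | ∃ (a b : V) (e : a ⟶ b), x = ofPath k e.toPath}).asIdeal

instance [Fintype V] : (arrowIdeal k V).IsTwoSided :=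
  inferInstanceAs (TwoSidedIdeal.asIdeal _).IsTwoSided

end PathAlgebra

/-- The radical square zero algebra `kQ/J²` of a quiver. -/
abbrev RadSqZeroAlgebra (k : Type u) [Field k] (V : Type u) [Quiver.{u} V] [Fintype V] :
    Type u :=
  PathAlgebra k V ⧸ (PathAlgebra.arrowIdeal k V * PathAlgebra.arrowIdeal k V)

/-! ### Differential projective modules -/

/-- A differential projective (left) module over a ring `Λ`. -/
structure DiffProj (Λ : Type u) [Ring Λ] where
  /-- the underlying module -/
  carrier : Type w
  [addCommGroup : AddCommGroup carrier]
  [module : Module Λ carrier]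
  [projective : Module.Projective Λ carrier]
  /-- the differential -/
  d : carrier →ₗ[Λ] carrier
  d_comp_d : d ∘ₗ d = 0

namespace DiffProj

variable {Λ : Type u} [Ring Λ]

attribute [instance] DiffProj.addCommGroup DiffProj.module DiffProj.projective

/-- A map of differential modules is a module map commuting with the differentials. -/
@[ext]
structure Hom (M N : DiffProj.{w} Λ) where
  /-- the underlying module map -/
  lin : M.carrier →ₗ[Λ] N.carrier
  comm : lin ∘ₗ M.d = N.d ∘ₗ lin

instance : Category (DiffProj.{w} Λ) where
  Hom M N := Hom M N
  id M := ⟨LinearMap.id, by rw [LinearMap.id_comp, LinearMap.comp_id]⟩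
  comp f g := ⟨g.lin ∘ₗ f.lin, by
    rw [LinearMap.comp_assoc, f.comm, ← LinearMap.comp_assoc, g.comm, LinearMap.comp_assoc]⟩

@[ext]
theorem hom_ext {M N : DiffProj.{w} Λ} {f g : M ⟶ N} (h : f.lin = g.lin) : f = g :=
  Hom.ext h

@[simp]
theorem id_lin (M : DiffProj.{w} Λ) : Hom.lin (𝟙 M) = LinearMap.id := rfl

@[simp]
theorem comp_lin {M N P : DiffProj.{w} Λ} (f : M ⟶ N) (g : N ⟶ P) :
    Hom.lin (f ≫ g) = g.lin ∘ₗ f.lin := rfl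

section
variable {M N : DiffProj.{w} Λ}

instance : Zero (M ⟶ N) := ⟨⟨0, by rw [LinearMap.zero_comp, LinearMap.comp_zero]⟩⟩

instance : Add (M ⟶ N) :=
  ⟨fun f g => ⟨f.lin + g.lin, by rw [LinearMap.add_comp, LinearMap.comp_add, f.comm, g.comm]⟩⟩

instance : Neg (M ⟶ N) :=
  ⟨fun f => ⟨-f.lin, by rw [LinearMap.neg_comp, LinearMap.comp_neg, f.comm]⟩⟩

instance : Sub (M ⟶ N) :=
  ⟨fun f g => ⟨f.lin - g.lin, by rw [LinearMap.sub_comp, LinearMap.comp_sub, f.comm, g.comm]⟩⟩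

instance : SMul ℕ (M ⟶ N) :=
  ⟨fun n f => ⟨n • f.lin, by rw [LinearMap.smul_comp, LinearMap.comp_smul, f.comm]⟩⟩

instance : SMul ℤ (M ⟶ N) :=
  ⟨fun n f => ⟨n • f.lin, by rw [LinearMap.smul_comp, LinearMap.comp_smul, f.comm]⟩⟩

theorem lin_injective : Function.Injective (fun f : M ⟶ N => f.lin) := fun _ _ h => hom_ext h

instance : AddCommGroup (M ⟶ N) :=
  lin_injective.addCommGroup _ rfl (fun _ _ => rfl) (fun _ => rfl) (fun _ _ => rfl)
    (fun _ _ => rfl) (fun _ _ => rfl)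

@[simp] theorem zero_lin : Hom.lin (0 : M ⟶ N) = 0 := rfl
@[simp] theorem add_lin (f g : M ⟶ N) : Hom.lin (f + g) = f.lin + g.lin := rfl
@[simp] theorem neg_lin (f : M ⟶ N) : Hom.lin (-f) = -f.lin := rfl
@[simp] theorem sub_lin (f g : M ⟶ N) : Hom.lin (f - g) = f.lin - g.lin := rfl

/-- `f : M ⟶ N` is null homotopic if `f = r d + δ r` for some module map `r : M → N`, where
`d`, `δ` are the differentials of `M`, `N`. -/
def NullHomotopic (f : M ⟶ N) : Prop :=
  ∃ r : M.carrier →ₗ[Λ] N.carrier, f.lin = r ∘ₗ M.d + N.d ∘ₗ r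

end

instance : Preadditive (DiffProj.{w} Λ) where
  add_comp _ _ _ f f' g := hom_ext (LinearMap.comp_add _ _ _)
  comp_add _ _ _ f g g' := hom_ext (LinearMap.add_comp _ _ _)

/-- The direct sum of two differential projective modules. -/
abbrev prod (M N : DiffProj.{w} Λ) : DiffProj.{w} Λ where
  carrier := M.carrier × N.carrier
  d := M.d.prodMap N.d
  d_comp_d := by rw [LinearMap.prodMap_comp, M.d_comp_d, N.d_comp_d, LinearMap.prodMap_zero]

/-- `M` is contractible if its identity map is null homotopic. -/
def Contractible (M : DiffProj.{w} Λ) : Prop := NullHomotopic (𝟙 M)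

/-- `M` is reduced if it has no nonzero contractible direct summands. -/
def Reduced (M : DiffProj.{w} Λ) : Prop :=
  ∀ N P : DiffProj.{w} Λ, Nonempty (M ≅ N.prod P) → N.Contractible → Subsingleton N.carrier

/-- `M''` is a reduced part of `M` if `M ≅ M' ⊕ M''` as differential modules with `M'`
contractible and `M''` reduced. -/
def IsReducedPart (M'' M : DiffProj.{w} Λ) : Prop :=
  M''.Reduced ∧ ∃ M' : DiffProj.{w} Λ, M'.Contractible ∧ Nonempty (M ≅ M'.prod M'')

/-- The direct sum of a family of differential projective modules. -/
abbrev directSum {L : Type w} (X : L → DiffProj.{w} Λ) : DiffProj.{w} Λ where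
  carrier := ⨁ l, (X l).carrier
  d := DirectSum.lmap fun l => (X l).d
  d_comp_d := by
    rw [← DirectSum.lmap_comp]
    refine LinearMap.ext fun x => DFinsupp.ext fun l => ?_
    rw [DirectSum.lmap_apply, (X l).d_comp_d]
    rfl

/-- The inclusion of a summand into the direct sum. -/
def inj {L : Type w} [DecidableEq L] (X : L → DiffProj.{w} Λ) (l : L) : X l ⟶ directSum X where
  lin := DirectSum.lof Λ L (fun l => (X l).carrier) l
  comm := LinearMap.ext fun x => (DirectSum.lmap_lof (fun l => (X l).d) l x).symm

/-- The map out of a direct sum given by its components. -/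
def desc {L : Type w} [DecidableEq L] {X : L → DiffProj.{w} Λ} {N : DiffProj.{w} Λ}
    (f : ∀ l, X l ⟶ N) : directSum X ⟶ N where
  lin := DirectSum.toModule Λ L N.carrier fun l => (f l).lin
  comm := by
    refine DirectSum.linearMap_ext Λ fun l => LinearMap.ext fun x => ?_
    have h := LinearMap.congr_fun (f l).comm x
    simp only [LinearMap.comp_apply] at h ⊢
    erw [DirectSum.lmap_lof, DirectSum.toModule_lof, DirectSum.toModule_lof]
    exact h

theorem inj_desc {L : Type w} [DecidableEq L] {X : L → DiffProj.{w} Λ} {N : DiffProj.{w} Λ}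
    (f : ∀ l, X l ⟶ N) (l : L) : inj X l ≫ desc f = f l :=
  hom_ext (LinearMap.ext fun x => DirectSum.toModule_lof (φ := fun l => (f l).lin) Λ l x)

theorem nullHomotopic_of_inj {L : Type w} [DecidableEq L] {X : L → DiffProj.{w} Λ}
    {N : DiffProj.{w} Λ} (f : directSum X ⟶ N) (h : ∀ l, NullHomotopic (inj X l ≫ f)) :
    NullHomotopic f := by
  choose r hr using h
  refine ⟨DirectSum.toModule Λ L N.carrier r, ?_⟩
  refine DirectSum.linearMap_ext Λ fun l => LinearMap.ext fun x => ?_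
  have h := LinearMap.congr_fun (hr l) x
  simp only [LinearMap.comp_apply, LinearMap.add_apply] at h ⊢
  erw [DirectSum.lmap_lof, DirectSum.toModule_lof, DirectSum.toModule_lof]
  exact h

/-- Homotopy of maps of differential projective modules. -/
def homotopyRel (Λ : Type u) [Ring Λ] : HomRel (DiffProj.{w} Λ) :=
  fun _ _ f g => NullHomotopic (f - g)

theorem NullHomotopic.add {M N : DiffProj.{w} Λ} {f g : M ⟶ N} (hf : NullHomotopic f)
    (hg : NullHomotopic g) : NullHomotopic (f + g) := by
  obtain ⟨r, hr⟩ := hf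
  obtain ⟨s, hs⟩ := hg
  refine ⟨r + s, ?_⟩
  rw [add_lin, hr, hs, LinearMap.add_comp, LinearMap.comp_add]
  abel

theorem NullHomotopic.neg {M N : DiffProj.{w} Λ} {f : M ⟶ N} (hf : NullHomotopic f) :
    NullHomotopic (-f) := by
  obtain ⟨r, hr⟩ := hf
  refine ⟨-r, ?_⟩
  rw [neg_lin, hr, LinearMap.neg_comp, LinearMap.comp_neg]
  abel

theorem NullHomotopic.precomp {M N P : DiffProj.{w} Λ} (f : M ⟶ N) {g : N ⟶ P}
    (hg : NullHomotopic g) : NullHomotopic (f ≫ g) := by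
  obtain ⟨r, hr⟩ := hg
  refine ⟨r ∘ₗ f.lin, ?_⟩
  rw [comp_lin, hr, LinearMap.add_comp, LinearMap.comp_assoc, LinearMap.comp_assoc,
    LinearMap.comp_assoc, f.comm]

theorem NullHomotopic.postcomp {M N P : DiffProj.{w} Λ} {f : M ⟶ N} (g : N ⟶ P)
    (hf : NullHomotopic f) : NullHomotopic (f ≫ g) := by
  obtain ⟨r, hr⟩ := hf
  refine ⟨g.lin ∘ₗ r, ?_⟩
  rw [comp_lin, hr, LinearMap.comp_add, ← LinearMap.comp_assoc, ← LinearMap.comp_assoc,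
    ← LinearMap.comp_assoc, g.comm]

theorem nullHomotopic_zero (M N : DiffProj.{w} Λ) : NullHomotopic (0 : M ⟶ N) :=
  ⟨0, by rw [zero_lin, LinearMap.zero_comp, LinearMap.comp_zero, add_zero]⟩

instance : Congruence (homotopyRel.{w} Λ) where
  equivalence :=
    { refl := fun f => by
        unfold homotopyRel
        rw [sub_self]
        exact nullHomotopic_zero _ _
      symm := fun {f g} h => by
        have := NullHomotopic.neg h
        rwa [neg_sub] at this
      trans := fun {f g h} h1 h2 => by
        have := NullHomotopic.add h1 h2
        rwa [sub_add_sub_cancel] at this }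
  comp_left {_ _ _} f {_ _} h := by
    have := NullHomotopic.precomp f h
    rwa [Preadditive.comp_sub] at this
  comp_right {_ _ _} {_ _} g h := by
    have := NullHomotopic.postcomp g h
    rwa [Preadditive.sub_comp] at this

end DiffProj

/-- The homotopy category of differential projective `Λ`-modules: its objects are the
differential projective `Λ`-modules, its morphisms are the maps of differential modules modulo the
null homotopic ones. -/
abbrev DiffProjHomotopyCategory (Λ : Type u) [Ring Λ] : Type (max u (w + 1)) :=
  CategoryTheory.Quotient (DiffProj.homotopyRel.{w} Λ)

namespace DiffProjHomotopyCategory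

variable {Λ : Type u} [Ring Λ]

instance : Preadditive (DiffProjHomotopyCategory.{w} Λ) :=
  CategoryTheory.Quotient.preadditive _ (fun _ _ f₁ f₂ g₁ g₂ h h' => by
    have := DiffProj.NullHomotopic.add h h'
    rwa [← add_sub_add_comm] at this)

open scoped Classical in
/-- The homotopy category has all small coproducts, given by direct sums. -/
instance : HasCoproducts.{w} (DiffProjHomotopyCategory.{w} Λ) :=
  hasCoproducts_of_colimit_cofans
    (fun X => Cofan.mk
      (⟨DiffProj.directSum fun l => (X l).as⟩ : DiffProjHomotopyCategory.{w} Λ)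
      (fun l => (CategoryTheory.Quotient.functor (DiffProj.homotopyRel.{w} Λ)).map
        (DiffProj.inj (fun l => (X l).as) l)))
    (fun X => Cofan.IsColimit.mk _
      (fun s => (CategoryTheory.Quotient.functor (DiffProj.homotopyRel.{w} Λ)).map
        (DiffProj.desc (fun l => (s.inj l).out)))
      (fun s l => by
        dsimp only [cofan_mk_inj]
        rw [← Functor.map_comp, DiffProj.inj_desc]
        exact Quot.out_eq _)
      (fun s m hm => by
        obtain ⟨m, rfl⟩ := Quot.exists_rep m
        refine CategoryTheory.Quotient.sound _ (DiffProj.nullHomotopic_of_inj _ fun l => ?_)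
        rw [Preadditive.comp_sub, DiffProj.inj_desc]
        refine (CategoryTheory.Quotient.functor_map_eq_iff (DiffProj.homotopyRel.{w} Λ) _ _).1 ?_
        rw [Functor.map_comp]
        exact (hm l).trans (Quot.out_eq _).symm))

end DiffProjHomotopyCategory

open scoped Classical in
/-- An object `S` of an additive category with small coproducts is compact if for every small
family `X` of objects, the natural map `⨁ Hom(S, X l) → Hom(S, ∐ X)` is an epimorphism.
(This map is always injective.) -/
def CompactObject {C : Type*} [Category C] [Preadditive C] [HasCoproducts.{w} C] (S : C) : Prop :=
  ∀ (L : Type w) (X : L → C), Function.Surjective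
    (DirectSum.toAddMonoid (fun l => Preadditive.rightComp S (Sigma.ι X l)) :
      (⨁ l, (S ⟶ X l)) →+ (S ⟶ ∐ X))

/-- The compact objects of the homotopy category. -/
def compactObjects (Λ : Type u) [Ring Λ] : ObjectProperty (DiffProjHomotopyCategory.{w} Λ) :=
  fun M => CompactObject.{w} M

/-- The objects of the homotopy category whose reduced part is finite dimensional over `k`. -/
def finDimObjects (k : Type u) [Field k] (Λ : Type u) [Ring Λ] [Algebra k Λ] :
    ObjectProperty (DiffProjHomotopyCategory.{w} Λ) :=
  fun M => ∃ M'' : DiffProj.{w} Λ, M''.IsReducedPart M.as ∧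
    Module.Finite k (RestrictScalars k Λ M''.carrier)

end

noncomputable section

/-! ### Coefficients in the path algebra -/

/-! Write rad M for the submodule generated by all arrow multiples of elements of M. Arrows
annihilate it, so an endomorphism with image in rad M vanishes on rad M, and such endomorphisms
multiply to zero. Call a differential module minimal if its differential has image in the radical. A
minimal module has no nonzero contractible summand: an identity map of the form rd + dr would have
image in the radical. Conversely, every differential projective module is contractible plus minimal
(`exists_contractible_prod_minimal`). Modulo the radical the differential is von Neumann regular,
which gives a null homotopic idempotent there; this lifts because the obstruction ideal has square
zero. So reduced parts can be studied through minimal modules.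

A finite dimensional reduced part is finitely generated, so maps from it into a direct sum land in a
finite subsum; this gives the inclusion (`compactObject_of_fg`).

Let Q be acyclic and M compact and minimal. One shows that the top M/rad M is finite dimensional at
every vertex a, starting from the sinks (`FiniteTopAt.of_successors`). If the tops at the successors
of a are finite dimensional, only finitely many elements at a are needed to express the differential
of generators at those successors. Dividing the top at a by these elements gives a vector space with
basis I and a chain map from M to a direct sum of I copies of Λ with zero differential. Homotopies
change this map only inside the radical, so compactness forces I to be finite.

If there is a cycle at v, take the projective module with one generator for each path ending at v,
the differential of a generator being the sum over all extensions by an arrow at the start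
(`pathModule`). A map out of it is null homotopic as soon as it kills the generator of the trivial
path (`nullHomotopic_of_pathGen_nil`), so the module is compact. It is minimal and has infinitely
many generators, so its reduced part is infinite dimensional. -/

/-- The arrows of a quiver. -/
abbrev QuiverArrows (V : Type u) [Quiver.{u} V] : Type u := Σ a b : V, a ⟶ b

namespace PathAlgebra

variable {k : Type u} [Field k] {V : Type u} [Quiver.{u} V]

open scoped Classical in
/-- The indicator function of the trivial path at `a`. -/
def vertexIndicator (k : Type u) [Field k] (a : V) : QuiverPaths V → k
  | ⟨x, _, Quiver.Path.nil⟩ => if x = a then 1 else 0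
  | ⟨_, _, Quiver.Path.cons _ _⟩ => 0

open scoped Classical in
/-- The indicator function of the path of length one given by the arrow `e`. -/
def arrowIndicator (k : Type u) [Field k] (e : QuiverArrows V) : QuiverPaths V → k
  | ⟨_, _, Quiver.Path.nil⟩ => 0
  | ⟨x, y, Quiver.Path.cons Quiver.Path.nil f⟩ => if (⟨x, y, f⟩ : QuiverArrows V) = e then 1 else 0
  | ⟨_, _, Quiver.Path.cons (Quiver.Path.cons _ _) _⟩ => 0

/-- The coefficient of the trivial path at `a`. -/
def vertexCoeff (k : Type u) [Field k] (a : V) : PathAlgebra k V →ₗ[k] k :=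
  Finsupp.linearCombination k (vertexIndicator k a)

/-- The coefficient of the arrow `e`. -/
def arrowCoeff (k : Type u) [Field k] (e : QuiverArrows V) : PathAlgebra k V →ₗ[k] k :=
  Finsupp.linearCombination k (arrowIndicator k e)

theorem vertexCoeff_ofPath (c : V) {a b : V} (p : Quiver.Path a b) :
    vertexCoeff k c (ofPath k p) = vertexIndicator k c ⟨a, b, p⟩ := by
  unfold vertexCoeff ofPath
  erw [Finsupp.linearCombination_single, one_smul]

theorem arrowCoeff_ofPath (e : QuiverArrows V) {a b : V} (p : Quiver.Path a b) :
    arrowCoeff k e (ofPath k p) = arrowIndicator k e ⟨a, b, p⟩ := by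
  unfold arrowCoeff ofPath
  erw [Finsupp.linearCombination_single, one_smul]

/-- Two bilinear maps on the path algebra agree if they agree on paths. -/
theorem bilinear_ext {f g : PathAlgebra k V →ₗ[k] PathAlgebra k V →ₗ[k] k}
    (h : ∀ {a b c d : V} (p : Quiver.Path a b) (q : Quiver.Path c d),
      f (ofPath k p) (ofPath k q) = g (ofPath k p) (ofPath k q)) : f = g := by
  ext x y
  induction x using induction_on with
  | zero => simp only [map_zero, LinearMap.zero_apply]
  | add x x' h h' => simp only [map_add, LinearMap.add_apply, h, h']
  | smul c x h => simp only [map_smul, LinearMap.smul_apply, h]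
  | path p =>
    induction y using induction_on with
    | zero => simp only [map_zero]
    | add x x' h h' => simp only [map_add, h, h']
    | smul c x h => simp only [map_smul, h]
    | path q => exact h p q

theorem vertexCoeff_mul (a : V) (x y : PathAlgebra k V) :
    vertexCoeff k a (x * y) = vertexCoeff k a x * vertexCoeff k a y := by
  have : (mulLin k).compr₂ (vertexCoeff k a) =
      (LinearMap.mul k k).compl₁₂ (vertexCoeff k a) (vertexCoeff k a) := by
    refine bilinear_ext fun {i j m n} p q => ?_
    simp only [LinearMap.compr₂_apply, LinearMap.compl₁₂_apply, LinearMap.mul_apply', ← mul_def]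
    by_cases h : n = i
    · subst h
      rw [ofPath_mul_ofPath]
      simp only [vertexCoeff_ofPath]
      rcases p with _ | ⟨p, f⟩ <;> rcases q with _ | ⟨q, g⟩ <;> simp [vertexIndicator]
    · rw [ofPath_mul_ofPath_of_ne _ _ h, map_zero]
      simp only [vertexCoeff_ofPath]
      rcases p with _ | ⟨p, f⟩ <;> rcases q with _ | ⟨q, g⟩ <;> simp [vertexIndicator]
      rintro rfl
      exact Ne.symm h
  exact LinearMap.congr_fun₂ this x y

/-- A product of two paths is an arrow only if one factor is that arrow and the other is the trivial
path at its target or source. This Leibniz rule is what makes the functional vanish on J². -/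
theorem arrowCoeff_mul (e : QuiverArrows V) (x y : PathAlgebra k V) :
    arrowCoeff k e (x * y) =
      vertexCoeff k e.2.1 x * arrowCoeff k e y + arrowCoeff k e x * vertexCoeff k e.1 y := by
  have : (mulLin k).compr₂ (arrowCoeff k e) =
      (LinearMap.mul k k).compl₁₂ (vertexCoeff k e.2.1) (arrowCoeff k e) +
      (LinearMap.mul k k).compl₁₂ (arrowCoeff k e) (vertexCoeff k e.1) := by
    refine bilinear_ext fun {i j m n} p q => ?_
    simp only [LinearMap.compr₂_apply, LinearMap.compl₁₂_apply, LinearMap.mul_apply', ← mul_def,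
      LinearMap.add_apply]
    obtain ⟨s, t, e⟩ := e
    by_cases h : n = i
    · subst h
      rw [ofPath_mul_ofPath]
      simp only [vertexCoeff_ofPath, arrowCoeff_ofPath]
      rcases p with _ | ⟨_ | ⟨p, f'⟩, f⟩ <;> rcases q with _ | ⟨_ | ⟨q, g'⟩, g⟩ <;>
        simp [vertexIndicator, arrowIndicator] <;> grind
    · rw [ofPath_mul_ofPath_of_ne _ _ h, map_zero]
      simp only [vertexCoeff_ofPath, arrowCoeff_ofPath]
      rcases p with _ | ⟨_ | ⟨p, f'⟩, f⟩ <;> rcases q with _ | ⟨_ | ⟨q, g'⟩, g⟩ <;>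
        simp [vertexIndicator, arrowIndicator] <;> grind
  exact LinearMap.congr_fun₂ this x y

variable [Fintype V]

/-- The functional is multiplicative, so its kernel is a two-sided ideal, and that ideal contains
every arrow. -/
theorem vertexCoeff_of_mem_arrowIdeal (a : V) {x : PathAlgebra k V} (hx : x ∈ arrowIdeal k V) :
    vertexCoeff k a x = 0 := by
  let I : TwoSidedIdeal (PathAlgebra k V) := TwoSidedIdeal.mk' {x | vertexCoeff k a x = 0}
    (map_zero _) (fun {x y} hx hy => by simp_all) (fun {x} hx => by simp_all)
    (fun {x y} hx => by simp_all [vertexCoeff_mul]) (fun {x y} hx => by simp_all [vertexCoeff_mul])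
  have h : TwoSidedIdeal.span
      {x : PathAlgebra k V | ∃ (a b : V) (e : a ⟶ b), x = ofPath k e.toPath} ≤ I := by
    rw [TwoSidedIdeal.span_le]
    rintro _ ⟨b, c, e, rfl⟩
    simp [I, vertexCoeff_ofPath, vertexIndicator, Quiver.Hom.toPath]
  have := h (show x ∈ TwoSidedIdeal.span _ from hx)
  simpa [I] using this

theorem vertexCoeff_of_mem_sq (a : V) {x : PathAlgebra k V}
    (hx : x ∈ arrowIdeal k V * arrowIdeal k V) : vertexCoeff k a x = 0 :=
  vertexCoeff_of_mem_arrowIdeal a (Ideal.mul_le_left hx)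

theorem arrowCoeff_of_mem_sq (e : QuiverArrows V) {x : PathAlgebra k V}
    (hx : x ∈ arrowIdeal k V * arrowIdeal k V) : arrowCoeff k e x = 0 := by
  refine Submodule.mul_induction_on hx (fun y hy z hz => ?_) fun y z hy hz => ?_
  · simp [arrowCoeff_mul, vertexCoeff_of_mem_arrowIdeal _ hy, vertexCoeff_of_mem_arrowIdeal _ hz]
  · rw [map_add, hy, hz, add_zero]

theorem ofPath_toPath_mem {a b : V} (e : a ⟶ b) : ofPath k e.toPath ∈ arrowIdeal k V :=
  TwoSidedIdeal.subset_span (R := PathAlgebra k V) ⟨a, b, e, rfl⟩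

end PathAlgebra

/-! ### Generators, relations and coefficient functionals of the radical square zero algebra -/

namespace RadSqZeroAlgebra

open PathAlgebra

variable {k : Type u} [Field k] {V : Type u} [Quiver.{u} V] [Fintype V]

scoped instance : Ring (RadSqZeroAlgebra k V) := inferInstance
scoped instance : Semiring (RadSqZeroAlgebra k V) := inferInstance
scoped instance : Monoid (RadSqZeroAlgebra k V) := inferInstance
scoped instance : MonoidWithZero (RadSqZeroAlgebra k V) := inferInstance

variable (k) in
/-- The idempotent of the vertex `a`. -/
def vert (a : V) : RadSqZeroAlgebra k V :=
  Ideal.Quotient.mk _ (ofPath k (Quiver.Path.nil : Quiver.Path a a))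

variable (k) in
/-- The class of the arrow `e`. -/
def arr (e : QuiverArrows V) : RadSqZeroAlgebra k V :=
  Ideal.Quotient.mk _ (ofPath k e.2.2.toPath)

theorem vert_mul_vert_self (a : V) : vert k a * vert k a = vert k a := by
  rw [vert, ← map_mul, ofPath_mul_ofPath, Quiver.Path.comp_nil]

theorem vert_mul_vert {a b : V} (h : a ≠ b) : vert k a * vert k b = 0 := by
  rw [vert, vert, ← map_mul, ofPath_mul_ofPath_of_ne _ _ h.symm, map_zero]

theorem sum_vert : ∑ a : V, vert k a = 1 := by
  simp only [vert]
  rw [← map_sum, ← one_def, map_one]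

theorem vert_mul_arr (e : QuiverArrows V) : vert k e.2.1 * arr k e = arr k e := by
  rw [vert, arr, ← map_mul, ofPath_mul_ofPath, Quiver.Path.comp_nil]

theorem arr_mul_vert (e : QuiverArrows V) : arr k e * vert k e.1 = arr k e := by
  rw [vert, arr, ← map_mul, ofPath_mul_ofPath, Quiver.Path.nil_comp]

theorem vert_mul_arr_of_ne {b : V} {e : QuiverArrows V} (h : b ≠ e.2.1) :
    vert k b * arr k e = 0 := by
  rw [← vert_mul_arr, ← mul_assoc, vert_mul_vert h, zero_mul]

theorem arr_mul_vert_of_ne {a : V} {e : QuiverArrows V} (h : e.1 ≠ a) :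
    arr k e * vert k a = 0 := by
  rw [← arr_mul_vert, mul_assoc, vert_mul_vert h, mul_zero]

theorem arr_mul_arr (e f : QuiverArrows V) : arr k e * arr k f = 0 := by
  rw [arr, arr, ← map_mul, Ideal.Quotient.eq_zero_iff_mem]
  exact Ideal.mul_mem_mul (ofPath_toPath_mem _) (ofPath_toPath_mem _)

theorem mk_smul (c : k) (x : PathAlgebra k V) :
    (Ideal.Quotient.mk (arrowIdeal k V * arrowIdeal k V) (c • x) : RadSqZeroAlgebra k V) =
      c • Ideal.Quotient.mk _ x := rfl

/-- Paths of length at least two lie in J², so the classes of trivial paths and arrows span the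
quotient. -/
theorem induction {P : RadSqZeroAlgebra k V → Prop} (x : RadSqZeroAlgebra k V) (zero : P 0)
    (add : ∀ x y, P x → P y → P (x + y)) (smul : ∀ (c : k) x, P x → P (c • x))
    (vert : ∀ a, P (vert k a)) (arr : ∀ e, P (arr k e)) : P x := by
  obtain ⟨x, rfl⟩ := Ideal.Quotient.mk_surjective x
  induction x using induction_on with
  | zero => rwa [map_zero]
  | add x y hx hy => rw [map_add]; exact add _ _ hx hy
  | smul c x hx => rw [mk_smul]; exact smul _ _ hx
  | @path a b p =>
    rcases p with _ | ⟨_ | ⟨p, f⟩, e⟩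
    · exact vert a
    · exact arr ⟨_, _, e⟩
    · have : ofPath k ((p.cons f).cons e) = ofPath k e.toPath * (ofPath k f.toPath * ofPath k p) := by
        rw [ofPath_mul_ofPath, ofPath_mul_ofPath]
        rfl
      rw [this, Ideal.Quotient.eq_zero_iff_mem.2]
      · exact zero
      · exact Ideal.mul_mem_mul (ofPath_toPath_mem _)
          (Ideal.mul_mem_right _ _ (ofPath_toPath_mem _))

variable (k) in
/-- The coefficient of the idempotent of `a`. -/
def vertCoeff (a : V) : RadSqZeroAlgebra k V →ₗ[k] k where
  toFun := QuotientAddGroup.lift _ (vertexCoeff k a).toAddMonoidHom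
    fun _ hx => vertexCoeff_of_mem_sq a hx
  map_add' := map_add _
  map_smul' c x := by
    obtain ⟨x, rfl⟩ := Ideal.Quotient.mk_surjective x
    exact map_smul (vertexCoeff k a) c x

variable (k) in
/-- The coefficient of the arrow `e`. -/
def arrCoeff (e : QuiverArrows V) : RadSqZeroAlgebra k V →ₗ[k] k where
  toFun := QuotientAddGroup.lift _ (arrowCoeff k e).toAddMonoidHom
    fun _ hx => arrowCoeff_of_mem_sq e hx
  map_add' := map_add _
  map_smul' c x := by
    obtain ⟨x, rfl⟩ := Ideal.Quotient.mk_surjective x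
    exact map_smul (arrowCoeff k e) c x

theorem vertCoeff_mk (a : V) (x : PathAlgebra k V) :
    vertCoeff k a (Ideal.Quotient.mk _ x) = vertexCoeff k a x := rfl

theorem arrCoeff_mk (e : QuiverArrows V) (x : PathAlgebra k V) :
    arrCoeff k e (Ideal.Quotient.mk _ x) = arrowCoeff k e x := rfl

theorem vertCoeff_mul (a : V) (x y : RadSqZeroAlgebra k V) :
    vertCoeff k a (x * y) = vertCoeff k a x * vertCoeff k a y := by
  obtain ⟨x, rfl⟩ := Ideal.Quotient.mk_surjective x
  obtain ⟨y, rfl⟩ := Ideal.Quotient.mk_surjective y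
  exact vertexCoeff_mul a x y

theorem arrCoeff_mul (e : QuiverArrows V) (x y : RadSqZeroAlgebra k V) :
    arrCoeff k e (x * y) =
      vertCoeff k e.2.1 x * arrCoeff k e y + arrCoeff k e x * vertCoeff k e.1 y := by
  obtain ⟨x, rfl⟩ := Ideal.Quotient.mk_surjective x
  obtain ⟨y, rfl⟩ := Ideal.Quotient.mk_surjective y
  exact arrowCoeff_mul e x y

@[simp]
theorem vertCoeff_vert_self (a : V) : vertCoeff k a (vert k a) = 1 := by
  simp [vert, vertCoeff_mk, vertexCoeff_ofPath, vertexIndicator]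

theorem vertCoeff_vert_of_ne {a b : V} (h : b ≠ a) : vertCoeff k a (vert k b) = 0 := by
  simp [vert, vertCoeff_mk, vertexCoeff_ofPath, vertexIndicator, h]

@[simp]
theorem vertCoeff_arr (a : V) (e : QuiverArrows V) : vertCoeff k a (arr k e) = 0 := by
  simp [arr, vertCoeff_mk, vertexCoeff_ofPath, vertexIndicator, Quiver.Hom.toPath]

@[simp]
theorem arrCoeff_arr_self (e : QuiverArrows V) : arrCoeff k e (arr k e) = 1 := by
  simp [arr, arrCoeff_mk, arrowCoeff_ofPath, arrowIndicator, Quiver.Hom.toPath]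

theorem arrCoeff_arr_of_ne {e f : QuiverArrows V} (h : f ≠ e) : arrCoeff k e (arr k f) = 0 := by
  have : arrowIndicator k e ⟨f.1, f.2.1, f.2.2.toPath⟩ = 0 := if_neg h
  rw [arr, arrCoeff_mk, arrowCoeff_ofPath, this]

end RadSqZeroAlgebra

namespace RadSqZeroAlgebra

variable {k : Type u} [Field k] {V : Type u} [Quiver.{u} V] [Fintype V]

/-! ### The radical of a module -/

section Radical

variable {M N : Type*} [AddCommGroup M] [Module (RadSqZeroAlgebra k V) M]
  [AddCommGroup N] [Module (RadSqZeroAlgebra k V) N]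

variable (k V M) in
/-- The radical of a module, the submodule generated by the multiples of the arrows. -/
def rad : Submodule (RadSqZeroAlgebra k V) M :=
  Submodule.span _ {x | ∃ (e : QuiverArrows V) (m : M), x = arr k e • m}

theorem arr_smul_mem_rad (e : QuiverArrows V) (m : M) : arr k e • m ∈ rad k V M :=
  Submodule.subset_span ⟨e, m, rfl⟩

theorem arr_mul_mul_arr (e f : QuiverArrows V) (x : RadSqZeroAlgebra k V) :
    arr k e * x * arr k f = 0 := by
  induction x using induction with
  | zero => simp
  | add x y hx hy => rw [mul_add, add_mul, hx, hy, add_zero]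
  | smul c x hx => rw [mul_smul_comm, smul_mul_assoc, hx, smul_zero]
  | vert a =>
    by_cases h : e.1 = a
    · subst h
      rw [arr_mul_vert, arr_mul_arr]
    · rw [arr_mul_vert_of_ne h, zero_mul]
  | arr g => rw [arr_mul_arr, zero_mul]

theorem arr_smul_of_mem_rad (e : QuiverArrows V) {x : M} (hx : x ∈ rad k V M) :
    arr k e • x = 0 := by
  induction hx using Submodule.closure_induction with
  | zero => simp
  | add x y _ _ hx hy => rw [smul_add, hx, hy, add_zero]
  | smul_mem r x hx =>
    obtain ⟨f, m, rfl⟩ := hx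
    rw [← mul_smul, ← mul_smul, arr_mul_mul_arr, zero_smul]

theorem map_mem_rad (f : M →ₗ[RadSqZeroAlgebra k V] N) {x : M} (hx : x ∈ rad k V M) :
    f x ∈ rad k V N := by
  have : rad k V M ≤ (rad k V N).comap f := by
    refine Submodule.span_le.2 ?_
    rintro _ ⟨e, m, rfl⟩
    simpa using arr_smul_mem_rad e (f m)
  exact this hx

theorem smul_mem_rad_of_mem {r : RadSqZeroAlgebra k V}
    (hr : r ∈ rad k V (RadSqZeroAlgebra k V)) (x : M) : r • x ∈ rad k V M :=
  map_mem_rad (LinearMap.toSpanSingleton (RadSqZeroAlgebra k V) M x) hr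

/-- A map with image in the radical vanishes on the radical. -/
theorem map_eq_zero_of_mem_rad {f : M →ₗ[RadSqZeroAlgebra k V] N} (hf : ∀ x, f x ∈ rad k V N)
    {x : M} (hx : x ∈ rad k V M) : f x = 0 := by
  have : rad k V M ≤ LinearMap.ker f := by
    refine Submodule.span_le.2 ?_
    rintro _ ⟨e, m, rfl⟩
    simpa using arr_smul_of_mem_rad e (hf m)
  exact this hx

variable (k) in
theorem sum_vert_smul (x : M) : ∑ a : V, vert k a • x = x := by
  rw [← Finset.sum_smul, sum_vert, one_smul]

theorem arr_smul_vert_smul (e : QuiverArrows V) (x : M) : arr k e • vert k e.1 • x = arr k e • x := by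
  rw [← mul_smul, arr_mul_vert]

theorem vert_smul_vert_smul (a : V) (x : M) : vert k a • vert k a • x = vert k a • x := by
  rw [← mul_smul, vert_mul_vert_self]

variable (k) in
theorem vert_smul_vert_smul_of_ne {a b : V} (h : a ≠ b) (x : M) :
    vert k a • vert k b • x = 0 := by
  rw [← mul_smul, vert_mul_vert h, zero_smul]

/-- The arrows with target `c`. -/
abbrev ArrowsTo (c : V) : Type u := Σ a : V, a ⟶ c

/-- An arrow with target `c`, as an arrow. -/
abbrev ArrowsTo.arrow {c : V} (e : ArrowsTo c) : QuiverArrows V := ⟨e.1, c, e.2⟩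

omit [Fintype V] in
theorem ArrowsTo.arrow_injective (c : V) :
    Function.Injective (ArrowsTo.arrow : ArrowsTo c → QuiverArrows V) := by
  rintro ⟨a, e⟩ ⟨b, f⟩ h
  cases h
  rfl

section Finite

variable [∀ a b : V, Finite (a ⟶ b)]

scoped instance (a b : V) : Fintype (a ⟶ b) := Fintype.ofFinite _

/-- Finiteness of the set of arrows allows a single sum indexed by all arrows. The coefficients can
be moved to the sources because an arrow absorbs the idempotent of its source. -/
theorem exists_eq_sum_of_mem_rad {x : M} (hx : x ∈ rad k V M) :
    ∃ y : QuiverArrows V → M, (∀ e, vert k e.1 • y e = y e) ∧ x = ∑ e, arr k e • y e := by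
  suffices ∃ y : QuiverArrows V → M, x = ∑ e, arr k e • y e by
    obtain ⟨y, rfl⟩ := this
    exact ⟨fun e => vert k e.1 • y e, fun e => vert_smul_vert_smul _ _,
      by simp only [arr_smul_vert_smul]⟩
  induction hx using Submodule.closure_induction with
  | zero => exact ⟨0, by simp⟩
  | add x y _ _ hx hy =>
    obtain ⟨x, rfl⟩ := hx
    obtain ⟨y, rfl⟩ := hy
    exact ⟨x + y, by simp [Finset.sum_add_distrib]⟩
  | smul_mem r x hx =>
    obtain ⟨f, m, rfl⟩ := hx
    classical
    have key : ∀ z : M, ∃ y : QuiverArrows V → M, arr k f • z = ∑ e, arr k e • y e := fun z =>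
      ⟨Pi.single f z, by
        rw [Finset.sum_eq_single f, Pi.single_eq_same]
        · intro e _ he
          rw [Pi.single_eq_of_ne he, smul_zero]
        · simp⟩
    induction r using induction with
    | zero => exact ⟨0, by simp⟩
    | add r s hr hs =>
      obtain ⟨x, hx⟩ := hr
      obtain ⟨y, hy⟩ := hs
      exact ⟨x + y, by simp [Finset.sum_add_distrib, add_smul, hx, hy]⟩
    | smul c r hr =>
      obtain ⟨y, hy⟩ := hr
      refine ⟨fun e => algebraMap k (RadSqZeroAlgebra k V) c • y e, ?_⟩
      rw [Algebra.smul_def, mul_smul, hy, Finset.smul_sum]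
      simp only [← mul_smul, Algebra.commutes]
    | vert a =>
      by_cases h : a = f.2.1
      · subst h
        rw [← mul_smul, vert_mul_arr]
        exact key m
      · exact ⟨0, by rw [← mul_smul, vert_mul_arr_of_ne h]; simp⟩
    | arr g => exact ⟨0, by rw [← mul_smul, arr_mul_arr]; simp⟩

theorem vert_smul_sum_arr (c : V) (y : QuiverArrows V → M) :
    vert k c • ∑ e, arr k e • y e = ∑ e : ArrowsTo c, arr k e.arrow • y e.arrow := by
  rw [Finset.smul_sum]
  refine (Fintype.sum_of_injective _ (ArrowsTo.arrow_injective c) _ _ ?_ ?_).symm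
  · rintro ⟨a, b, e⟩ he
    rw [← mul_smul, vert_mul_arr_of_ne, zero_smul]
    rintro rfl
    exact he ⟨⟨a, e⟩, rfl⟩
  · rintro e
    rw [← mul_smul, vert_mul_arr e.arrow]

end Finite

theorem vert_mul_sub_mem_rad (a : V) (x : RadSqZeroAlgebra k V) :
    vert k a * x - vertCoeff k a x • vert k a ∈ rad k V (RadSqZeroAlgebra k V) := by
  have hk : ∀ (c : k) {y}, y ∈ rad k V (RadSqZeroAlgebra k V) →
      c • y ∈ rad k V (RadSqZeroAlgebra k V) := fun c y hy => by
    rw [Algebra.smul_def]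
    exact Submodule.smul_mem _ _ hy
  induction x using induction with
  | zero => simp
  | add x y hx hy =>
    convert add_mem hx hy using 1
    rw [map_add, mul_add, add_smul]
    abel
  | smul c x hx =>
    convert hk c hx using 1
    rw [map_smul, mul_smul_comm, smul_sub, smul_assoc]
  | vert b =>
    by_cases h : a = b
    · subst h
      rw [vert_mul_vert_self, vertCoeff_vert_self, one_smul, sub_self]
      exact zero_mem _
    · rw [vert_mul_vert h, vertCoeff_vert_of_ne (Ne.symm h), zero_smul, sub_self]
      exact zero_mem _
  | arr e =>
    rw [vertCoeff_arr, zero_smul, sub_zero]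
    refine Submodule.smul_mem _ (vert k a) ?_
    simpa using arr_smul_mem_rad (k := k) e (1 : RadSqZeroAlgebra k V)

theorem vertCoeff_of_mem_rad (a : V) {x : RadSqZeroAlgebra k V}
    (hx : x ∈ rad k V (RadSqZeroAlgebra k V)) : vertCoeff k a x = 0 := by
  induction hx using Submodule.closure_induction with
  | zero => simp
  | add x y _ _ hx hy => rw [map_add, hx, hy, add_zero]
  | smul_mem r x hx =>
    obtain ⟨f, m, rfl⟩ := hx
    simp [vertCoeff_mul]

/-- Multiples of different arrows are independent in a projective module. -/
theorem vert_smul_mem_rad_of_sum_eq_zero [Module.Projective (RadSqZeroAlgebra k V) N]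
    {ι : Type*} [Fintype ι] {φ : ι → QuiverArrows V} (hφ : Function.Injective φ) {x : ι → N}
    (hx : ∑ i, arr k (φ i) • x i = 0) (i : ι) : vert k (φ i).1 • x i ∈ rad k V N := by
  obtain ⟨s, hs⟩ := Module.projective_def'.1
    (inferInstance : Module.Projective (RadSqZeroAlgebra k V) N)
  -- Via the splitting `s`, the relation is read coefficientwise in a free module. The functional of
  -- the arrow `φ i` kills all other summands, by injectivity of `φ`, and on the `i`-th it returns
  -- the vertex coefficient at the source, which therefore vanishes.
  have key : ∀ n : N, vert k (φ i).1 * s (x i) n ∈ rad k V (RadSqZeroAlgebra k V) := by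
    intro n
    have h1 : ∑ j, arr k (φ j) * s (x j) n = 0 := by
      have := congr(s $hx n)
      simpa [Finsupp.finsetSum_apply] using this
    have h2 : vertCoeff k (φ i).1 (s (x i) n) = 0 := by
      have := congr(arrCoeff k (φ i) $h1)
      rw [map_sum, map_zero, Finset.sum_eq_single i] at this
      · simpa [arrCoeff_mul] using this
      · intro j _ hj
        rw [arrCoeff_mul, vertCoeff_arr, arrCoeff_arr_of_ne (hφ.ne hj), zero_mul, zero_mul,
          add_zero]
      · simp
    have := vert_mul_sub_mem_rad (φ i).1 (s (x i) n)
    rwa [h2, zero_smul, sub_zero] at this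
  have h := LinearMap.congr_fun hs (vert k (φ i).1 • x i)
  rw [LinearMap.comp_apply, LinearMap.id_apply, map_smul, Finsupp.linearCombination_apply] at h
  rw [← h]
  refine Submodule.sum_mem _ fun n _ => ?_
  exact smul_mem_rad_of_mem (key n) _

end Radical

/-! ### Endomorphisms of projective modules modulo the radical -/

section ScalarTower

variable {M N : Type*} [AddCommGroup M] [Module (RadSqZeroAlgebra k V) M] [Module k M]
  [IsScalarTower k (RadSqZeroAlgebra k V) M]
  [AddCommGroup N] [Module (RadSqZeroAlgebra k V) N] [Module k N]
  [IsScalarTower k (RadSqZeroAlgebra k V) N]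

/-- A linear map over the base field that commutes with the generators of the algebra is linear
over the algebra. -/
def linearMapOfCommute (f : M →ₗ[k] N) (hv : ∀ (a : V) x, f (vert k a • x) = vert k a • f x)
    (ha : ∀ (e : QuiverArrows V) x, f (arr k e • x) = arr k e • f x) : M →ₗ[RadSqZeroAlgebra k V] N where
  toFun := f
  map_add' := map_add f
  map_smul' r x := by
    dsimp only [RingHom.id_apply]
    induction r using induction with
    | zero => simp
    | add r s hr hs => rw [add_smul, map_add, hr, hs, add_smul]
    | smul c r hr => rw [smul_assoc, map_smul, hr, smul_assoc]
    | vert a => exact hv a x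
    | arr e => exact ha e x

end ScalarTower

/-- The endomorphism ring of a projective module is von Neumann regular modulo the radical. -/
theorem exists_regular_mod_rad {M : Type*} [AddCommGroup M] [Module (RadSqZeroAlgebra k V) M]
    [Module.Projective (RadSqZeroAlgebra k V) M] (d : M →ₗ[RadSqZeroAlgebra k V] M) :
    ∃ r : M →ₗ[RadSqZeroAlgebra k V] M, ∀ x, d (r (d x)) - d x ∈ rad k V M := by
  let _ : Module k M := Module.compHom M (algebraMap k (RadSqZeroAlgebra k V))
  have : IsScalarTower k (RadSqZeroAlgebra k V) M :=
    ⟨fun c r x => by rw [Algebra.smul_def, mul_smul]; rfl⟩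
  have hc : ∀ (c : k) (r : RadSqZeroAlgebra k V) (x : M), r • c • x = c • r • x := fun c r x => by
    rw [← smul_assoc c, ← algebraMap_smul (RadSqZeroAlgebra k V) c x, ← mul_smul,
      Algebra.smul_def, Algebra.commutes]
  let q := (rad k V M).mkQ
  let D : (M ⧸ rad k V M) →ₗ[RadSqZeroAlgebra k V] (M ⧸ rad k V M) :=
    (rad k V M).mapQ (rad k V M) d fun x hx => map_mem_rad d hx
  have hD : ∀ x, D (q x) = q (d x) := fun x => rfl
  let Dk : (M ⧸ rad k V M) →ₗ[k] (M ⧸ rad k V M) := D.restrictScalars k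
  -- Over a field a quasi-inverse exists: project onto the range, then apply a section of the map
  -- onto it.
  obtain ⟨ρ, hρ⟩ : ∃ ρ : (M ⧸ rad k V M) →ₗ[k] (M ⧸ rad k V M), ∀ x, D (ρ (D x)) = D x := by
    obtain ⟨s, hs⟩ := Dk.rangeRestrict.exists_rightInverse_of_surjective (by simp)
    obtain ⟨p, hp⟩ := (LinearMap.range Dk).subtype.exists_leftInverse_of_injective (by simp)
    refine ⟨s ∘ₗ p, fun x => ?_⟩
    have h1 : p (D x) = Dk.rangeRestrict x := LinearMap.congr_fun hp (Dk.rangeRestrict x)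
    have h2 := LinearMap.congr_fun hs (Dk.rangeRestrict x)
    rw [LinearMap.comp_apply, h1]
    exact congrArg Subtype.val h2
  have hz : ∀ (e : QuiverArrows V) (x : M ⧸ rad k V M), arr k e • x = 0 := fun e x => by
    obtain ⟨x, rfl⟩ := (rad k V M).mkQ_surjective x
    change Submodule.Quotient.mk (arr k e • x) = _
    exact (Submodule.Quotient.mk_eq_zero _).2 (arr_smul_mem_rad (k := k) e x)
  have hcq : ∀ (c : k) (r : RadSqZeroAlgebra k V) (x : M ⧸ rad k V M), r • c • x = c • r • x := by
    intro c r x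
    obtain ⟨x, rfl⟩ := (rad k V M).mkQ_surjective x
    exact congrArg _ (hc c r x)
  -- Keeping only the diagonal blocks of `ρ` makes it commute with the vertex idempotents. Arrows
  -- act as zero on the quotient, so the result is linear over the algebra, and projectivity lifts
  -- it to `M`.
  let σ : (M ⧸ rad k V M) →ₗ[k] (M ⧸ rad k V M) :=
    { toFun := fun x => ∑ a : V, vert k a • ρ (vert k a • x)
      map_add' := fun x y => by simp [Finset.sum_add_distrib]
      map_smul' := fun c x => by simp [Finset.smul_sum, hcq] }
  let S : (M ⧸ rad k V M) →ₗ[RadSqZeroAlgebra k V] (M ⧸ rad k V M) :=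
    linearMapOfCommute σ (fun a x => by
      change ∑ b : V, vert k b • ρ (vert k b • vert k a • x) =
        vert k a • ∑ b : V, vert k b • ρ (vert k b • x)
      rw [Finset.smul_sum]
      refine Finset.sum_congr rfl fun b _ => ?_
      by_cases h : b = a
      · subst h
        rw [vert_smul_vert_smul, vert_smul_vert_smul]
      · rw [vert_smul_vert_smul_of_ne k h, vert_smul_vert_smul_of_ne k (Ne.symm h), map_zero,
          smul_zero])
      (fun e x => by rw [hz, hz, map_zero])
  have hS : ∀ x, D (S (D x)) = D x := fun x => by
    change D (∑ a : V, vert k a • ρ (vert k a • D x)) = D x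
    rw [map_sum]
    refine (Finset.sum_congr rfl fun a _ => ?_).trans (sum_vert_smul k (D x))
    rw [map_smul, ← map_smul D (vert k a) x, hρ, map_smul, vert_smul_vert_smul]
  obtain ⟨r, hr⟩ := Module.projective_lifting_property (rad k V M).mkQ (S ∘ₗ (rad k V M).mkQ)
    (rad k V M).mkQ_surjective
  refine ⟨r, fun x => ?_⟩
  rw [← Submodule.Quotient.eq]
  have h1 : q (r (d x)) = S (q (d x)) := LinearMap.congr_fun hr (d x)
  change q (d (r (d x))) = q (d x)
  rw [← hD, h1, ← hD, hS]

end RadSqZeroAlgebra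

/-! ### Compactness in terms of maps of differential modules -/

namespace DiffProj

variable {Λ : Type u} [Ring Λ]

open scoped Classical in
/-- A map into a direct sum is finitely supported up to homotopy. -/
def FinitelySupported {M : DiffProj.{w} Λ} {L : Type w} {X : L → DiffProj.{w} Λ}
    (f : M ⟶ directSum X) : Prop :=
  ∃ (s : Finset L) (φ : ∀ l, M ⟶ X l), NullHomotopic (f - ∑ l ∈ s, φ l ≫ inj X l)

open scoped Classical in
/-- The direct sum is a coproduct in the homotopy category. -/
def directSumIsColimit {L : Type w} (X : L → DiffProjHomotopyCategory.{w} Λ) :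
    IsColimit (Cofan.mk (⟨directSum fun l => (X l).as⟩ : DiffProjHomotopyCategory.{w} Λ)
      (fun l => (CategoryTheory.Quotient.functor (homotopyRel.{w} Λ)).map
        (inj (fun l => (X l).as) l)) : Cofan X) :=
  Cofan.IsColimit.mk _
    (fun s => (CategoryTheory.Quotient.functor (homotopyRel.{w} Λ)).map
      (desc (fun l => (s.inj l).out)))
    (fun s l => by
      dsimp only [cofan_mk_inj]
      rw [← Functor.map_comp, inj_desc]
      exact Quot.out_eq _)
    (fun s m hm => by
      obtain ⟨m, rfl⟩ := Quot.exists_rep m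
      refine CategoryTheory.Quotient.sound _ (nullHomotopic_of_inj _ fun l => ?_)
      rw [Preadditive.comp_sub, inj_desc]
      refine (CategoryTheory.Quotient.functor_map_eq_iff (homotopyRel.{w} Λ) _ _).1 ?_
      rw [Functor.map_comp]
      exact (hm l).trans (Quot.out_eq _).symm)

theorem functor_map_sub_sum {M N : DiffProj.{w} Λ} {L : Type w} (s : Finset L)
    (φ : L → (M ⟶ N)) :
    (CategoryTheory.Quotient.functor (homotopyRel.{w} Λ)).map (∑ l ∈ s, φ l) =
      ∑ l ∈ s, (CategoryTheory.Quotient.functor (homotopyRel.{w} Λ)).map (φ l) := by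
  classical
  induction s using Finset.induction_on with
  | empty => rfl
  | insert a s ha ih =>
    rw [Finset.sum_insert ha, Finset.sum_insert ha, ← ih]
    rfl

/-- The abstract coproduct is identified with the direct sum, and homotopy classes are replaced by
representatives; later arguments need only honest maps. -/
theorem compactObject_iff (M : DiffProjHomotopyCategory.{w} Λ) :
    CompactObject.{w} M ↔ ∀ (L : Type w) (X : L → DiffProj.{w} Λ) (f : M.as ⟶ directSum X),
      FinitelySupported f := by
  classical
  let F := CategoryTheory.Quotient.functor (homotopyRel.{w} Λ)
  have iso : ∀ {L : Type w} (X : L → DiffProjHomotopyCategory.{w} Λ),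
      ∃ e : ∐ X ≅ (⟨directSum fun l => (X l).as⟩ : DiffProjHomotopyCategory.{w} Λ),
        ∀ l, Sigma.ι X l ≫ e.hom = F.map (inj (fun l => (X l).as) l) := fun X =>
    ⟨(coproductIsCoproduct X).coconePointUniqueUpToIso (directSumIsColimit X), fun l =>
      IsColimit.comp_coconePointUniqueUpToIso_hom _ _ (Discrete.mk l)⟩
  constructor
  · intro h L X f
    obtain ⟨e, he⟩ := iso (fun l => (⟨X l⟩ : DiffProjHomotopyCategory.{w} Λ))
    obtain ⟨t, ht⟩ := h L (fun l => ⟨X l⟩) (F.map f ≫ e.inv)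
    refine ⟨t.support, fun l => (t l).out,
      (CategoryTheory.Quotient.functor_map_eq_iff (homotopyRel.{w} Λ) _ _).1 ?_⟩
    rw [functor_map_sub_sum]
    have h1 : F.map f = (F.map f ≫ e.inv) ≫ e.hom := by simp
    refine h1.trans ?_
    rw [← ht, ← DirectSum.sum_support_of t, map_sum, Preadditive.sum_comp]
    rw [DirectSum.sum_support_of t]
    refine Finset.sum_congr rfl fun l _ => ?_
    rw [DirectSum.toAddMonoid_of]
    change (t l ≫ Sigma.ι (fun l => (⟨X l⟩ : DiffProjHomotopyCategory.{w} Λ)) l) ≫ e.hom = _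
    rw [Category.assoc, he, Functor.map_comp]
    congr 1
    exact (Quot.out_eq _).symm
  · intro h L X g
    obtain ⟨e, he⟩ := iso X
    obtain ⟨f, hf⟩ : ∃ f : M.as ⟶ directSum fun l => (X l).as, F.map f = g ≫ e.hom :=
      ⟨(g ≫ e.hom).out, Quot.out_eq _⟩
    obtain ⟨s, φ, hφ⟩ := h L _ f
    refine ⟨∑ l ∈ s, DirectSum.of (fun l => M ⟶ X l) l (F.map (φ l)), ?_⟩
    rw [← cancel_mono e.hom, ← hf]
    have h2 := (CategoryTheory.Quotient.functor_map_eq_iff (homotopyRel.{w} Λ) _ _).2 hφ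
    refine Eq.trans ?_ h2.symm
    rw [functor_map_sub_sum, map_sum, Preadditive.sum_comp]
    refine Finset.sum_congr rfl fun l _ => ?_
    rw [DirectSum.toAddMonoid_of]
    change ((show M ⟶ X l from F.map (φ l)) ≫ Sigma.ι X l) ≫ e.hom = _
    rw [Category.assoc, he, Functor.map_comp]

/-- The projection of a direct sum to a summand. -/
def proj {L : Type w} (X : L → DiffProj.{w} Λ) (l : L) : directSum X ⟶ X l where
  lin := DirectSum.component Λ L (fun l => (X l).carrier) l
  comm := LinearMap.ext fun x => DirectSum.lmap_apply (fun l => (X l).d) x l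

theorem sum_lin {M N : DiffProj.{w} Λ} {L : Type*} (s : Finset L) (φ : L → (M ⟶ N)) :
    Hom.lin (∑ l ∈ s, φ l : M ⟶ N) = ∑ l ∈ s, (φ l).lin := by
  classical
  induction s using Finset.induction_on with
  | empty => rfl
  | insert a s ha ih => rw [Finset.sum_insert ha, Finset.sum_insert ha, add_lin, ih]

open scoped Classical in
/-- The part of a map into a direct sum that is supported in `s` agrees with the map at the
elements whose image is supported in `s`. -/
theorem sum_proj_inj_apply {M : DiffProj.{w} Λ} {L : Type w} {X : L → DiffProj.{w} Λ}
    (f : M ⟶ directSum X) (s : Finset L) (x : M.carrier)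
    (hx : ∀ l ∉ s, (f.lin x : ⨁ l, (X l).carrier) l = 0) :
    Hom.lin (∑ l ∈ s, (f ≫ proj X l) ≫ inj X l : M ⟶ directSum X) x = f.lin x := by
  rw [sum_lin, LinearMap.sum_apply]
  refine DFinsupp.ext fun m => ?_
  rw [DFinsupp.finsetSum_apply]
  have h : ∀ l, (Hom.lin ((f ≫ proj X l) ≫ inj X l) x : ⨁ l, (X l).carrier) m =
      if m = l then (f.lin x : ⨁ l, (X l).carrier) m else 0 := by
    intro l
    change DirectSum.of (fun l => (X l).carrier) l ((f.lin x : ⨁ l, (X l).carrier) l) m = _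
    split_ifs with h
    · subst h
      exact DirectSum.of_eq_same _ _
    · exact DirectSum.of_eq_of_ne _ _ _ h
  simp_rw [h]
  rw [Finset.sum_ite_eq]
  split_ifs with hm
  · rfl
  · exact (hx m hm).symm

/-- The images of finitely many generators involve only finitely many summands, so no homotopy is
needed. -/
theorem FinitelySupported.of_fg {M : DiffProj.{w} Λ} [hM : Module.Finite Λ M.carrier]
    {L : Type w} {X : L → DiffProj.{w} Λ} (f : M ⟶ directSum X) : FinitelySupported f := by
  classical
  obtain ⟨t, ht⟩ := hM.fg_top
  let s : Finset L := t.biUnion fun x => DFinsupp.support (f.lin x : ⨁ l, (X l).carrier)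
  refine ⟨s, fun l => f ≫ proj X l, ?_⟩
  have : f = ∑ l ∈ s, (f ≫ proj X l) ≫ inj X l := by
    refine hom_ext (LinearMap.ext_on ht fun x hx => ?_)
    refine (sum_proj_inj_apply f s x fun l hl => ?_).symm
    by_contra h
    exact hl (Finset.mem_biUnion.2 ⟨x, hx, DFinsupp.mem_support_toFun _ _ |>.2 h⟩)
  rw [← this, sub_self]
  exact nullHomotopic_zero _ _

theorem FinitelySupported.precomp {M N : DiffProj.{w} Λ} (g : N ⟶ M)
    {L : Type w} {X : L → DiffProj.{w} Λ} {f : M ⟶ directSum X} (hf : FinitelySupported f) :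
    FinitelySupported (g ≫ f) := by
  classical
  obtain ⟨s, φ, h⟩ := hf
  refine ⟨s, fun l => g ≫ φ l, ?_⟩
  have := NullHomotopic.precomp g h
  rw [Preadditive.comp_sub, Preadditive.comp_sum] at this
  simpa only [Category.assoc] using this

theorem FinitelySupported.of_nullHomotopic_sub {M : DiffProj.{w} Λ}
    {L : Type w} {X : L → DiffProj.{w} Λ} {f g : M ⟶ directSum X} (hf : FinitelySupported f)
    (h : NullHomotopic (g - f)) : FinitelySupported g := by
  classical
  obtain ⟨s, φ, h'⟩ := hf
  refine ⟨s, φ, ?_⟩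
  have := h.add h'
  rwa [sub_add_sub_cancel] at this

/-- The first inclusion of a direct sum. -/
def prodInl (M N : DiffProj.{w} Λ) : M ⟶ M.prod N where
  lin := LinearMap.inl Λ _ _
  comm := by ext <;> simp

/-- The second inclusion of a direct sum. -/
def prodInr (M N : DiffProj.{w} Λ) : N ⟶ M.prod N where
  lin := LinearMap.inr Λ _ _
  comm := by ext <;> simp

/-- The first projection of a direct sum. -/
def prodFst (M N : DiffProj.{w} Λ) : M.prod N ⟶ M where
  lin := LinearMap.fst Λ _ _
  comm := by ext <;> simp

/-- The second projection of a direct sum. -/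
def prodSnd (M N : DiffProj.{w} Λ) : M.prod N ⟶ N where
  lin := LinearMap.snd Λ _ _
  comm := by ext <;> simp

theorem prodInr_snd (M N : DiffProj.{w} Λ) : prodInr M N ≫ prodSnd M N = 𝟙 N :=
  hom_ext (LinearMap.snd_comp_inr Λ _ _)

theorem prodInl_fst (M N : DiffProj.{w} Λ) : prodInl M N ≫ prodFst M N = 𝟙 M :=
  hom_ext (LinearMap.fst_comp_inl Λ _ _)

theorem prod_decomp (M N : DiffProj.{w} Λ) :
    𝟙 (M.prod N) = prodFst M N ≫ prodInl M N + prodSnd M N ≫ prodInr M N :=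
  hom_ext (LinearMap.ext fun x => by simp [prodFst, prodInl, prodSnd, prodInr])

theorem compactObject_of_fg {M : DiffProjHomotopyCategory.{w} Λ} {M' M'' : DiffProj.{w} Λ}
    (e : M.as ≅ M'.prod M'') (hM' : M'.Contractible) (hM'' : Module.Finite Λ M''.carrier) :
    CompactObject.{w} M := by
  rw [compactObject_iff]
  intro L X f
  refine FinitelySupported.of_nullHomotopic_sub (f := (e.hom ≫ prodSnd M' M'') ≫
    (prodInr M' M'' ≫ e.inv ≫ f)) ((FinitelySupported.of_fg _).precomp _) ?_
  -- What remains of `f` factors through the identity of the contractible summand, hence is null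
  -- homotopic.
  have h : f - (e.hom ≫ prodSnd M' M'') ≫ (prodInr M' M'' ≫ e.inv ≫ f) =
      (e.hom ≫ prodFst M' M'') ≫ 𝟙 M' ≫ (prodInl M' M'' ≫ e.inv ≫ f) := by
    have h1 : f = e.hom ≫ 𝟙 _ ≫ e.inv ≫ f := by simp
    rw [sub_eq_iff_eq_add]
    conv_lhs => rw [h1, prod_decomp]
    simp
  rw [h]
  exact (NullHomotopic.postcomp _ hM').precomp _

/-- Compactness passes to direct summands. -/
theorem finitelySupported_of_retract {M : DiffProjHomotopyCategory.{w} Λ} (hM : CompactObject.{w} M)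
    {N : DiffProj.{w} Λ} (i : N ⟶ M.as) (p : M.as ⟶ N) (h : i ≫ p = 𝟙 N) {L : Type w}
    {X : L → DiffProj.{w} Λ} (f : N ⟶ directSum X) : FinitelySupported f := by
  have := ((compactObject_iff M).1 hM L X (p ≫ f)).precomp i
  rwa [← Category.assoc, h, Category.id_comp] at this

end DiffProj

namespace DiffProj

/-! ### Splitting idempotents -/

section Split

variable {Λ : Type u} [Ring Λ] {M : DiffProj.{w} Λ}

/-- The image of an idempotent. -/
abbrev image (e : M ⟶ M) (he : e ≫ e = e) : DiffProj.{w} Λ where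
  carrier := LinearMap.range e.lin
  projective := Module.Projective.of_split (LinearMap.range e.lin).subtype e.lin.rangeRestrict <|
    LinearMap.ext fun ⟨_, x, hx⟩ => Subtype.ext <| by
      subst hx
      exact LinearMap.congr_fun (congrArg Hom.lin he) x
  d := M.d.restrict (p := LinearMap.range e.lin) (q := LinearMap.range e.lin) <| by
    rintro _ ⟨x, rfl⟩
    exact ⟨M.d x, LinearMap.congr_fun e.comm x⟩
  d_comp_d := LinearMap.ext fun x => Subtype.ext (LinearMap.congr_fun M.d_comp_d x.1)

/-- The inclusion of the image of an idempotent. -/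
def imageι (e : M ⟶ M) (he : e ≫ e = e) : image e he ⟶ M where
  lin := (LinearMap.range e.lin).subtype
  comm := rfl

/-- The projection to the image of an idempotent. -/
def imageπ (e : M ⟶ M) (he : e ≫ e = e) : M ⟶ image e he where
  lin := e.lin.rangeRestrict
  comm := LinearMap.ext fun x => Subtype.ext (LinearMap.congr_fun e.comm x)

theorem imageι_π (e : M ⟶ M) (he : e ≫ e = e) : imageι e he ≫ imageπ e he = 𝟙 _ :=
  hom_ext <| LinearMap.ext fun ⟨_, x, hx⟩ => Subtype.ext <| by
    subst hx
    exact LinearMap.congr_fun (congrArg Hom.lin he) x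

theorem one_sub_idem {e : M ⟶ M} (he : e ≫ e = e) : (𝟙 M - e) ≫ (𝟙 M - e) = 𝟙 M - e := by
  simp [Preadditive.sub_comp, Preadditive.comp_sub, he]

theorem image_comp_one_sub {e : M ⟶ M} (he : e ≫ e = e) :
    imageι e he ≫ imageπ (𝟙 M - e) (one_sub_idem he) = 0 :=
  hom_ext <| LinearMap.ext fun ⟨_, x, hx⟩ => Subtype.ext <| by
    subst hx
    have := LinearMap.congr_fun (congrArg Hom.lin he) x
    exact sub_eq_zero.2 this.symm

theorem one_sub_comp_image {e : M ⟶ M} (he : e ≫ e = e) :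
    imageι (𝟙 M - e) (one_sub_idem he) ≫ imageπ e he = 0 :=
  hom_ext <| LinearMap.ext fun ⟨_, x, hx⟩ => Subtype.ext <| by
    subst hx
    have := LinearMap.congr_fun (congrArg Hom.lin he) x
    change e.lin (x - e.lin x) = 0
    rw [map_sub]
    exact sub_eq_zero.2 this.symm

/-- An idempotent splits a differential projective module. -/
def imageIso (e : M ⟶ M) (he : e ≫ e = e) :
    M ≅ (image e he).prod (image (𝟙 M - e) (one_sub_idem he)) where
  hom := imageπ e he ≫ prodInl _ _ + imageπ (𝟙 M - e) (one_sub_idem he) ≫ prodInr _ _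
  inv := prodFst _ _ ≫ imageι e he + prodSnd _ _ ≫ imageι (𝟙 M - e) (one_sub_idem he)
  hom_inv_id := by
    refine hom_ext (LinearMap.ext fun x => ?_)
    change (e.lin x + 0) + (0 + (x - e.lin x)) = x
    abel
  inv_hom_id := by
    rw [prod_decomp]
    simp only [Preadditive.add_comp, Preadditive.comp_add, Category.assoc]
    rw [reassoc_of% imageι_π e he, reassoc_of% imageι_π (𝟙 M - e) (one_sub_idem he),
      reassoc_of% image_comp_one_sub he, reassoc_of% one_sub_comp_image he]
    simp

theorem image_contractible {e : M ⟶ M} (he : e ≫ e = e) (h : NullHomotopic e) :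
    (image e he).Contractible := by
  have h1 : 𝟙 (image e he) = imageι e he ≫ e ≫ imageπ e he := by
    have h2 : e ≫ imageπ e he = imageπ e he ≫ imageι e he ≫ imageπ e he := rfl
    rw [h2, reassoc_of% imageι_π e he, imageι_π]
  unfold Contractible
  rw [h1]
  exact (NullHomotopic.postcomp _ h).precomp _

end Split

/-! ### Minimal differential modules -/

open RadSqZeroAlgebra

variable {k : Type u} [Field k] {V : Type u} [Quiver.{u} V] [Fintype V]

/-- A differential projective module is minimal if the image of its differential is contained in
its radical. -/
def Minimal (M : DiffProj.{w} (RadSqZeroAlgebra k V)) : Prop :=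
  ∀ x, M.d x ∈ rad k V M.carrier

theorem Minimal.of_retract {M N : DiffProj.{w} (RadSqZeroAlgebra k V)} (hM : M.Minimal)
    (i : N ⟶ M) (p : M ⟶ N) (h : i ≫ p = 𝟙 N) : N.Minimal := fun x => by
  have h1 : N.d x = p.lin (M.d (i.lin x)) := by
    have h2 := LinearMap.congr_fun i.comm x
    have h3 := LinearMap.congr_fun (congrArg Hom.lin h) (N.d x)
    exact h3.symm.trans (congrArg p.lin h2)
  rw [h1]
  exact map_mem_rad p.lin (hM _)

/-- A contracting homotopy puts the image of the identity into the radical, and a map with image in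
the radical kills the radical. -/
theorem Minimal.subsingleton_of_contractible {M : DiffProj.{w} (RadSqZeroAlgebra k V)}
    (hM : M.Minimal) (h : M.Contractible) : Subsingleton M.carrier := by
  obtain ⟨r, hr⟩ := h
  have key : ∀ x, (LinearMap.id : M.carrier →ₗ[RadSqZeroAlgebra k V] M.carrier) x ∈
      rad k V M.carrier := fun x => by
    have := LinearMap.congr_fun hr x
    rw [id_lin] at this
    rw [this]
    exact add_mem (map_mem_rad r (hM x)) (hM (r x))
  refine ⟨fun x y => ?_⟩
  have h0 : ∀ x : M.carrier, x = 0 := fun x => map_eq_zero_of_mem_rad key (key x)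
  rw [h0 x, h0 y]

theorem Minimal.subsingleton_of_iso {M N P : DiffProj.{w} (RadSqZeroAlgebra k V)}
    (hM : M.Minimal) (e : M ≅ N.prod P) (h : N.Contractible) : Subsingleton N.carrier :=
  (hM.of_retract (prodInl N P ≫ e.inv) (e.hom ≫ prodFst N P)
    (by simp [prodInl_fst])).subsingleton_of_contractible h

theorem Minimal.reduced {M : DiffProj.{w} (RadSqZeroAlgebra k V)} (hM : M.Minimal) : M.Reduced :=
  fun _ _ ⟨e⟩ h => hM.subsingleton_of_iso e h

/-! ### Lifting an idempotent modulo a square-zero ideal -/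

section Regular

variable {M : Type*} [AddCommGroup M] [Module (RadSqZeroAlgebra k V) M]

variable (k V M) in
/-- The ideal of endomorphisms with image in the radical. -/
def radEnd : AddSubgroup (Module.End (RadSqZeroAlgebra k V) M) where
  carrier := {f | ∀ x, f x ∈ rad k V M}
  zero_mem' _ := zero_mem _
  add_mem' hf hg x := add_mem (hf x) (hg x)
  neg_mem' hf x := neg_mem (hf x)

theorem radEnd_mul_left (f : Module.End (RadSqZeroAlgebra k V) M) {g} (hg : g ∈ radEnd k V M) :
    f * g ∈ radEnd k V M := fun x => map_mem_rad f (hg x)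

theorem radEnd_mul_right {f} (hf : f ∈ radEnd k V M) (g : Module.End (RadSqZeroAlgebra k V) M) :
    f * g ∈ radEnd k V M := fun x => hf (g x)

theorem radEnd_mul {f g} (hf : f ∈ radEnd k V M) (hg : g ∈ radEnd k V M) : f * g = 0 :=
  LinearMap.ext fun x => map_eq_zero_of_mem_rad hf (hg x)

/-- For a differential `d` on a projective module there is an idempotent `e` that is null homotopic
such that `d` agrees with `d * e` modulo the radical. -/
theorem exists_idempotent [Module.Projective (RadSqZeroAlgebra k V) M]
    {d : Module.End (RadSqZeroAlgebra k V) M} (hd : d * d = 0) :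
    ∃ e s : Module.End (RadSqZeroAlgebra k V) M, e * e = e ∧ e = s * d + d * s ∧ e * d = d * e ∧
      d - d * e ∈ radEnd k V M := by
  obtain ⟨r₀, ht⟩ := exists_regular_mod_rad d
  replace ht : d * r₀ * d - d ∈ radEnd k V M := ht
  set t := d * r₀ * d - d with ht'
  have h0 : d * r₀ * d = d + t := by rw [ht']; abel
  -- Modulo the radical `d * r₀` is idempotent, so flanking `r₀` by it and its complement makes `r *
  -- r` radical. Because `d * d = 0`, the factor `1 - d * r₀` disappears after multiplication by
  -- `d`, so `r` is still a quasi-inverse of `d`.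
  obtain ⟨r, hr⟩ : ∃ r, r = (1 - d * r₀) * r₀ * (d * r₀) := ⟨_, rfl⟩
  have hrr : r * r ∈ radEnd k V M := by
    have : r * r = (-((1 - d * r₀) * r₀)) * (t * (r₀ * (r₀ * (d * r₀)))) := by
      rw [hr, ht']
      noncomm_ring
    rw [this]
    exact radEnd_mul_left _ (radEnd_mul_right ht _)
  have hdrd : d * r * d - d ∈ radEnd k V M := by
    have : d * r * d - d = t * (r₀ * d) + t := by
      have h1 : d * r = (d * r₀ * d) * r₀ := by
        rw [hr]
        have : d * ((1 - d * r₀) * r₀ * (d * r₀)) =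
          d * r₀ * d * r₀ - (d * d) * (r₀ * r₀ * (d * r₀)) := by noncomm_ring
        rw [this, hd, zero_mul, sub_zero]
      rw [h1, h0, add_mul, add_mul, h0, mul_assoc t]
      abel
    rw [this]
    exact add_mem (radEnd_mul_right ht _) ht
  obtain ⟨h, hh⟩ : ∃ h, h = d * r + r * d := ⟨_, rfl⟩
  have hdh : d * h = d * r * d := by
    rw [hh, mul_add, ← mul_assoc, hd, zero_mul, zero_add, mul_assoc]
  have hhd : h * d = d * r * d := by
    rw [hh, add_mul, mul_assoc r, hd, mul_zero, add_zero]
  have hn : h * h - h ∈ radEnd k V M := by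
    have : h * h - h = (d * r * d - d) * r + r * (d * r * d - d) + d * (r * r * d) +
        r * (d * d) * r := by
      rw [hh]
      noncomm_ring
    rw [this, hd, mul_zero, zero_mul, add_zero]
    exact add_mem (add_mem (radEnd_mul_right hdrd _) (radEnd_mul_left _ hdrd))
      (radEnd_mul_left _ (radEnd_mul_right hrr _))
  have hnn := radEnd_mul hn hn
  have hcomm : d * h = h * d := hdh.trans hhd.symm
  have hdhr : d - d * h ∈ radEnd k V M := by
    rw [hdh, ← neg_sub]
    exact neg_mem hdrd
  -- The polynomial 3h² - 2h³ turns `h` into a true idempotent, since (h² - h)² = 0. The remaining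
  -- factor 3h - 2h² commutes with `d`, so multiplying the homotopy `r` by it gives a homotopy for
  -- the new idempotent.
  refine ⟨h * (3 * h - 2 * h * h), r * (3 * h - 2 * h * h), ?_, ?_, ?_, ?_⟩
  · have : h * (3 * h - 2 * h * h) - h * (3 * h - 2 * h * h) * (h * (3 * h - 2 * h * h)) =
        (h * h - h) * (h * h - h) * (3 - 4 * (h * h - h)) := by noncomm_ring
    rw [hnn, zero_mul, sub_eq_zero] at this
    exact this.symm
  · have h1 : d * (3 * h - 2 * h * h) = (3 * h - 2 * h * h) * d := by
      have : d * (3 * h - 2 * h * h) - (3 * h - 2 * h * h) * d = 3 * (d * h - h * d) -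
        2 * ((d * h - h * d) * h + h * (d * h - h * d)) := by noncomm_ring
      rw [hcomm, sub_self, mul_zero, zero_mul, mul_zero, add_zero, mul_zero, sub_zero] at this
      exact sub_eq_zero.1 this
    generalize 3 * h - 2 * h * h = g at h1
    rw [hh, add_mul, mul_assoc r d, h1, mul_assoc, mul_assoc, add_comm]
  · have : h * (3 * h - 2 * h * h) * d - d * (h * (3 * h - 2 * h * h)) =
      -(3 * ((d * h - h * d) * h + h * (d * h - h * d))) +
      2 * ((d * h - h * d) * h * h + h * (d * h - h * d) * h + h * h * (d * h - h * d)) := by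
      noncomm_ring
    rw [hcomm, sub_self] at this
    simpa [sub_eq_zero] using this
  · have : d - d * (h * (3 * h - 2 * h * h)) =
        (d - d * h) * (1 + h - 2 * h * h) := by noncomm_ring
    rw [this]
    exact radEnd_mul_right hdhr _

end Regular

/-- Every differential projective module is the direct sum of a contractible and a minimal one. -/
theorem exists_contractible_prod_minimal (M : DiffProj.{w} (RadSqZeroAlgebra k V)) :
    ∃ N P : DiffProj.{w} (RadSqZeroAlgebra k V), Nonempty (M ≅ N.prod P) ∧ N.Contractible ∧
      P.Minimal := by
  obtain ⟨e, s, hee, hes, hed, hm⟩ := exists_idempotent (d := M.d) M.d_comp_d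
  let E : M ⟶ M := ⟨e, hed⟩
  have hE : E ≫ E = E := hom_ext hee
  refine ⟨_, _, ⟨imageIso E hE⟩, image_contractible hE ⟨s, hes⟩, fun x => ?_⟩
  -- On the complement `e` is zero, so there `d` equals `d - d * e`, whose image is radical.
  have h1 : M.d x.1 ∈ rad k V M.carrier := by
    obtain ⟨_, y, rfl⟩ := x
    have h2 := hm (y - e y)
    change M.d (y - e y) ∈ _
    have h3 : e (y - e y) = 0 := by
      rw [map_sub, sub_eq_zero]
      exact (LinearMap.congr_fun hee y).symm
    simpa [h3] using h2
  have h4 := map_mem_rad (imageπ (𝟙 M - E) (one_sub_idem hE)).lin h1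
  have h5 := LinearMap.congr_fun (congrArg Hom.lin (imageι_π (𝟙 M - E) (one_sub_idem hE)))
    ((image (𝟙 M - E) (one_sub_idem hE)).d x)
  exact h5 ▸ h4

end DiffProj

namespace RadSqZeroAlgebra

variable {k : Type u} [Field k] {V : Type u} [Quiver.{u} V] [Fintype V]

/-! ### Projective modules with prescribed generators -/

section Generated

variable {I : Type u} (c : I → V)

variable (k) in
/-- The idempotent endomorphism of a free module given by a family of vertices. -/
def vertProj : (I →₀ RadSqZeroAlgebra k V) →ₗ[RadSqZeroAlgebra k V] (I →₀ RadSqZeroAlgebra k V) :=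
  Finsupp.linearCombination _ fun i => Finsupp.single i (vert k (c i))

theorem vertProj_single (i : I) (x : RadSqZeroAlgebra k V) :
    vertProj k c (Finsupp.single i x) = Finsupp.single i (x * vert k (c i)) := by
  rw [vertProj, Finsupp.linearCombination_single, Finsupp.smul_single, smul_eq_mul]

theorem vertProj_comp_self : vertProj k c ∘ₗ vertProj k c = vertProj k c := by
  refine Finsupp.lhom_ext fun i x => ?_
  rw [LinearMap.comp_apply, vertProj_single, vertProj_single, mul_assoc, vert_mul_vert_self]

variable (k) in
/-- The projective module freely generated by elements at the vertices `c i`. -/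
abbrev vertFree : Submodule (RadSqZeroAlgebra k V) (I →₀ RadSqZeroAlgebra k V) :=
  LinearMap.range (vertProj k c)

instance : Module.Projective (RadSqZeroAlgebra k V) (vertFree k c) :=
  Module.Projective.of_split (vertFree k c).subtype (vertProj k c).rangeRestrict <|
    LinearMap.ext fun ⟨_, x, hx⟩ => Subtype.ext <| by
      subst hx
      exact LinearMap.congr_fun (vertProj_comp_self c) x

variable (k) in
/-- The generators of `vertFree`. -/
def gen (i : I) : vertFree k c :=
  ⟨Finsupp.single i (vert k (c i)), Finsupp.single i 1, by rw [vertProj_single, one_mul]⟩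

theorem vert_smul_gen (i : I) : vert k (c i) • gen k c i = gen k c i :=
  Subtype.ext (by simp [gen, vert_mul_vert_self])

theorem span_gen : Submodule.span (RadSqZeroAlgebra k V) (Set.range (gen k c)) = ⊤ := by
  refine Submodule.eq_top_iff'.2 ?_
  rintro ⟨_, x, rfl⟩
  change (vertProj k c).rangeRestrict x ∈ _
  induction x using Finsupp.induction_linear with
  | zero =>
    rw [map_zero]
    exact zero_mem _
  | add x y hx hy =>
    rw [map_add]
    exact add_mem hx hy
  | single i x =>
    have : (vertProj k c).rangeRestrict (Finsupp.single i x) = x • gen k c i :=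
      Subtype.ext ((vertProj_single c i x).trans (by simp [gen]))
    rw [this]
    exact Submodule.smul_mem _ x (Submodule.subset_span (Set.mem_range_self i))

variable {N : Type*} [AddCommGroup N] [Module (RadSqZeroAlgebra k V) N]

/-- The linear map given by the images of the generators. -/
def genLift (y : I → N) : vertFree k c →ₗ[RadSqZeroAlgebra k V] N :=
  Finsupp.linearCombination _ y ∘ₗ (vertFree k c).subtype

theorem genLift_gen {y : I → N} (hy : ∀ i, vert k (c i) • y i = y i) (i : I) :
    genLift c y (gen k c i) = y i := by
  simp [genLift, gen, hy]

theorem gen_ext {f g : vertFree k c →ₗ[RadSqZeroAlgebra k V] N}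
    (h : ∀ i, f (gen k c i) = g (gen k c i)) : f = g :=
  LinearMap.ext_on_range (span_gen c) h

variable (k) in
theorem linearIndependent_single_vert :
    LinearIndependent k fun i => (Finsupp.single i (vert k (c i)) : I →₀ RadSqZeroAlgebra k V) := by
  classical
  rw [linearIndependent_iff']
  intro s g hg i hi
  have h1 := congr(vertCoeff k (c i) ($hg i))
  rw [Finsupp.finsetSum_apply, map_sum, Finset.sum_eq_single i] at h1
  · simpa using h1
  · intro j _ hj
    rw [Finsupp.smul_apply, Finsupp.single_eq_of_ne hj.symm, smul_zero, map_zero]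
  · exact fun h => absurd hi h

/-- Preimages of linearly independent elements are linearly independent, so the dimension of `W`
bounds their number. -/
theorem finite_of_single_vert_mem_range {W : Type*} [AddCommGroup W] [Module k W]
    [Module.Finite k W] (f : W →ₗ[k] (I →₀ RadSqZeroAlgebra k V))
    (hf : ∀ i, Finsupp.single i (vert k (c i)) ∈ LinearMap.range f) : Finite I := by
  choose w hw using hf
  have : LinearIndependent k (f ∘ w) := by
    rw [show f ∘ w = _ from funext hw]
    exact linearIndependent_single_vert k c
  exact (LinearIndependent.of_comp f this).finite

end Generated

end RadSqZeroAlgebra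

/-! ### The differential module of paths ending at a vertex -/

/-- Paths ending at `v`, built by adding arrows at the start. -/
inductive PathTo {V : Type u} [Quiver.{u} V] (v : V) : V → Type u
  | nil : PathTo v v
  | cons {a b : V} (e : a ⟶ b) (p : PathTo v b) : PathTo v a

namespace PathTo

variable {V : Type u} [Quiver.{u} V] {v : V}

/-- The number of arrows of a path. -/
def length : ∀ {a : V}, PathTo v a → ℕ
  | _, nil => 0
  | _, cons _ p => p.length + 1

/-- Composition of paths. -/
def append : ∀ {a b : V}, Quiver.Path a b → PathTo v b → PathTo v a
  | _, _, Quiver.Path.nil, p => p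
  | _, _, Quiver.Path.cons q e, p => append q (cons e p)

theorem length_append : ∀ {a b : V} (q : Quiver.Path a b) (p : PathTo v b),
    (append q p).length = q.length + p.length
  | _, _, Quiver.Path.nil, p => by simp [append]
  | _, _, Quiver.Path.cons q e, p => by
    rw [append, length_append, length, Quiver.Path.length_cons]
    omega

theorem infinite_of_cycle (q : Quiver.Path v v) (hq : q.length ≠ 0) :
    Infinite (Σ a : V, PathTo v a) := by
  have h : ∀ n : ℕ, ((append q)^[n] (nil : PathTo v v)).length = n * q.length := fun n => by
    induction n with
    | zero => simp [length]
    | succ n ih => rw [Function.iterate_succ_apply', length_append, ih]; ring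
  refine Infinite.of_injective
    (fun n : ℕ => (⟨v, (append q)^[n] nil⟩ : Σ a : V, PathTo v a)) fun m n hmn => ?_
  have := congrArg (fun p : Σ a : V, PathTo v a => p.2.length) hmn
  simp only [h] at this
  exact Nat.eq_of_mul_eq_mul_right (Nat.pos_of_ne_zero hq) this

end PathTo

namespace DiffProj

open RadSqZeroAlgebra

variable (k : Type u) [Field k] {V : Type u} [Quiver.{u} V] [Fintype V]
  [∀ a b : V, Finite (a ⟶ b)] (v : V)

/-- The generator given by a path. -/
abbrev pathGen {a : V} (p : PathTo v a) :
    vertFree k (Sigma.fst : (Σ a : V, PathTo v a) → V) := gen k _ ⟨a, p⟩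

/-- The differential of the module of paths: the sum over all ways to extend a path by one arrow at
its start. -/
def pathD : vertFree k (Sigma.fst : (Σ a : V, PathTo v a) → V) →ₗ[RadSqZeroAlgebra k V]
    vertFree k (Sigma.fst : (Σ a : V, PathTo v a) → V) :=
  genLift _ fun p => ∑ e : ArrowsTo p.1, arr k e.arrow • pathGen k v (PathTo.cons e.2 p.2)

theorem pathD_pathGen {a : V} (p : PathTo v a) : pathD k v (pathGen k v p) =
    ∑ e : ArrowsTo a, arr k e.arrow • pathGen k v (PathTo.cons e.2 p) := by
  refine genLift_gen _ (fun i => ?_) _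
  rw [Finset.smul_sum]
  refine Finset.sum_congr rfl fun e _ => ?_
  rw [← mul_smul, vert_mul_arr e.arrow]

theorem pathD_mem_rad (x) : pathD k v x ∈ rad k V _ := by
  have hx : x ∈ Submodule.span (RadSqZeroAlgebra k V) (Set.range (gen k _)) := by
    rw [span_gen]
    trivial
  induction hx using Submodule.span_induction with
  | zero =>
    rw [map_zero]
    exact zero_mem _
  | add x y _ _ hx hy =>
    rw [map_add]
    exact add_mem hx hy
  | smul r x _ hx =>
    rw [map_smul]
    exact Submodule.smul_mem _ _ hx
  | mem x hx =>
    obtain ⟨⟨a, p⟩, rfl⟩ := hx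
    rw [pathD_pathGen]
    exact Submodule.sum_mem _ fun e _ => arr_smul_mem_rad _ _

theorem pathD_comp_pathD : pathD k v ∘ₗ pathD k v = 0 := by
  refine LinearMap.ext fun x => ?_
  rw [LinearMap.comp_apply]
  exact map_eq_zero_of_mem_rad (pathD_mem_rad k v) (pathD_mem_rad k v x)

/-- The differential module of paths ending at `v`. -/
abbrev pathModule : DiffProj.{u} (RadSqZeroAlgebra k V) where
  carrier := vertFree k (Sigma.fst : (Σ a : V, PathTo v a) → V)
  d := pathD k v
  d_comp_d := pathD_comp_pathD k v

theorem pathModule_minimal : (pathModule k v).Minimal := pathD_mem_rad k v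

variable {k v}

/-- A map out of the module of paths that vanishes on the trivial path is null homotopic. -/
theorem nullHomotopic_of_pathGen_nil {N : DiffProj.{u} (RadSqZeroAlgebra k V)}
    (g : pathModule k v ⟶ N) (hg : g.lin (pathGen k v PathTo.nil) = 0) : NullHomotopic g := by
  -- The coefficients are chosen for every `x`, with the value 0 outside the radical, so that `R`
  -- can be defined by recursion before its arguments are known to be radical.
  have hdec : ∀ x : N.carrier, ∃ y : QuiverArrows V → N.carrier,
      (∀ e, vert k e.1 • y e = y e) ∧ (x ∈ rad k V N.carrier → x = ∑ e, arr k e • y e) := by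
    intro x
    by_cases hx : x ∈ rad k V N.carrier
    · obtain ⟨y, hy, h⟩ := exists_eq_sum_of_mem_rad hx
      exact ⟨y, hy, fun _ => h⟩
    · exact ⟨0, by simp, fun h => absurd h hx⟩
  choose dec hdec1 hdec2 using hdec
  -- Values of the homotopy on generators. The homotopy equation at `p` prescribes the sum of arrow
  -- multiples of the values at the one-arrow extensions of `p`; each value is taken to be the
  -- corresponding arrow coefficient.
  let R : ∀ {a : V}, PathTo v a → N.carrier := fun {a} p =>
    PathTo.rec (motive := fun _ _ => N.carrier) 0
      (fun {a b} e p x => dec (g.lin (pathGen k v p) - N.d x) ⟨a, b, e⟩) p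
  have hR0 : R (PathTo.nil : PathTo v v) = 0 := rfl
  have hR1 : ∀ {a b : V} (e : a ⟶ b) (p : PathTo v b),
      R (PathTo.cons e p) = dec (g.lin (pathGen k v p) - N.d (R p)) ⟨a, b, e⟩ := fun _ _ => rfl
  have hR : ∀ {a : V} (p : PathTo v a), vert k a • R p = R p := by
    intro a p
    cases p with
    | nil => rw [hR0, smul_zero]
    | cons e p => exact hdec1 _ ⟨_, _, e⟩
  have hv : ∀ {a : V} (p : PathTo v a), vert k a • (g.lin (pathGen k v p) - N.d (R p)) =
      g.lin (pathGen k v p) - N.d (R p) := fun {a} p => by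
    rw [smul_sub, ← map_smul, ← map_smul, hR, vert_smul_gen Sigma.fst ⟨a, p⟩]
  have hsum : ∀ {b : V} (p : PathTo v b), g.lin (pathGen k v p) - N.d (R p) ∈ rad k V N.carrier →
      g.lin (pathGen k v p) - N.d (R p) =
        ∑ e : ArrowsTo b, arr k e.arrow • R (PathTo.cons e.2 p) := by
    intro b p h
    have := vert_smul_sum_arr (k := k) b (dec (g.lin (pathGen k v p) - N.d (R p)))
    rwa [← hdec2 _ h, hv] at this
  have hcomm : ∀ {b : V} (p : PathTo v b), N.d (g.lin (pathGen k v p)) =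
      ∑ e : ArrowsTo b, arr k e.arrow • g.lin (pathGen k v (PathTo.cons e.2 p)) := by
    intro b p
    have := LinearMap.congr_fun g.comm (pathGen k v p)
    rw [LinearMap.comp_apply, LinearMap.comp_apply, pathD_pathGen, map_sum] at this
    simp only [map_smul] at this
    exact this.symm
  have hdd : ∀ x, N.d (N.d x) = 0 := fun x => LinearMap.congr_fun N.d_comp_d x
  have hmem : ∀ {a : V} (p : PathTo v a),
      g.lin (pathGen k v p) - N.d (R p) ∈ rad k V N.carrier := by
    intro a p
    induction p with
    | nil =>
      rw [hg, hR0, map_zero, sub_zero]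
      exact zero_mem _
    | @cons a b e p ih =>
      -- Applying the differential of `N` to the equation at `p` gives this relation. Independence
      -- of arrow multiples in the projective module `N` then makes the error at every extension
      -- radical, so the recursion continues.
      have hz : ∑ e : ArrowsTo b, arr k e.arrow •
          (g.lin (pathGen k v (PathTo.cons e.2 p)) - N.d (R (PathTo.cons e.2 p))) = 0 := by
        have h := congrArg N.d (hsum p ih)
        rw [map_sub, hdd, sub_zero, hcomm, map_sum] at h
        simp only [smul_sub, Finset.sum_sub_distrib, h, map_smul, sub_self]
      have := vert_smul_mem_rad_of_sum_eq_zero (ArrowsTo.arrow_injective b) hz ⟨a, e⟩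
      rwa [hv] at this
  refine ⟨genLift _ fun p => R p.2, gen_ext _ fun ⟨a, p⟩ => ?_⟩
  have h1 : ∀ {a : V} (p : PathTo v a),
      genLift (Sigma.fst : (Σ a : V, PathTo v a) → V) (fun p => R p.2) (pathGen k v p) = R p :=
    fun {a} p => genLift_gen Sigma.fst (y := fun p : Σ a : V, PathTo v a => R p.2)
      (fun i => hR i.2) ⟨a, p⟩
  rw [LinearMap.add_apply, LinearMap.comp_apply, LinearMap.comp_apply, h1, pathD_pathGen, map_sum]
  simp only [map_smul, h1]
  rw [← hsum p (hmem p), sub_add_cancel]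

-- Subtracting the components at the finite support of the image of the trivial path leaves a map
-- that kills that generator.
variable (k v) in
theorem pathModule_compact : CompactObject.{u}
    (⟨pathModule k v⟩ : DiffProjHomotopyCategory.{u} (RadSqZeroAlgebra k V)) := by
  classical
  rw [compactObject_iff]
  intro L X f
  refine ⟨DFinsupp.support (f.lin (pathGen k v PathTo.nil) : ⨁ l, (X l).carrier),
    fun l => f ≫ proj X l, nullHomotopic_of_pathGen_nil _ ?_⟩
  rw [sub_lin, LinearMap.sub_apply, sub_eq_zero]
  exact (sum_proj_inj_apply f _ _ fun l hl => DFinsupp.notMem_support_iff.1 hl).symm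

end DiffProj

/-! ### Compact minimal modules over acyclic quivers -/

namespace DiffProj

open RadSqZeroAlgebra

variable {k : Type u} [Field k] {V : Type u} [Quiver.{u} V] [Fintype V]

/-- The `a`-part of a module is finite dimensional modulo the radical. -/
def FiniteTopAt (k : Type u) [Field k] {V : Type u} [Quiver.{u} V] [Fintype V] (a : V)
    (M : Type*) [AddCommGroup M] [Module (RadSqZeroAlgebra k V) M] [Module k M]
    [IsScalarTower k (RadSqZeroAlgebra k V) M] : Prop :=
  ∃ F : Set M, F.Finite ∧ ∀ x : M,
    vert k a • x ∈ Submodule.span k F ⊔ (rad k V M).restrictScalars k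

theorem smul_mem_span_image (M : Type*) [AddCommGroup M] [Module (RadSqZeroAlgebra k V) M]
    [Module k M] [IsScalarTower k (RadSqZeroAlgebra k V) M] (r : RadSqZeroAlgebra k V) {F : Set M}
    {x : M} (hx : x ∈ Submodule.span k F) :
    r • x ∈ Submodule.span k ((fun y => r • y) '' F) := by
  have h : (Algebra.lsmul k k M r) x ∈ (Submodule.span k F).map (Algebra.lsmul k k M r) :=
    Submodule.mem_map_of_mem hx
  rwa [Submodule.map_span] at h

/-- The algebra as a differential module with zero differential. -/
abbrev trivialDifferential (k : Type u) [Field k] (V : Type u) [Quiver.{u} V] [Fintype V] :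
    DiffProj.{u} (RadSqZeroAlgebra k V) where
  carrier := RadSqZeroAlgebra k V
  d := 0
  d_comp_d := LinearMap.comp_zero 0

/-! ### The top at a vertex, given the tops at its successors -/

section Step

variable (k V)

/-- The inclusion of a vector space with basis `I` into the free module with basis `I`, at the
vertex `a`. -/
def vertEmb (I : Type u) (a : V) : (I →₀ k) →ₗ[k] (⨁ _ : I, RadSqZeroAlgebra k V) := by
  classical
  exact Finsupp.linearCombination k fun i =>
    DirectSum.lof (RadSqZeroAlgebra k V) I (fun _ => RadSqZeroAlgebra k V) i (vert k a)

variable {k V}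

theorem vertEmb_apply {I : Type u} (a : V) (z : I →₀ k) (i : I) :
    vertEmb k V I a z i = z i • vert k a := by
  classical
  induction z using Finsupp.induction_linear with
  | zero => simp
  | add x y hx hy => rw [map_add, DirectSum.add_apply, hx, hy, Finsupp.add_apply, add_smul]
  | single j c =>
    rw [vertEmb, Finsupp.linearCombination_single]
    change c • (DirectSum.of (fun _ => RadSqZeroAlgebra k V) j (vert k a) i) = _
    by_cases h : i = j
    · subst h
      rw [DirectSum.of_eq_same, Finsupp.single_eq_same]
    · rw [DirectSum.of_eq_of_ne _ _ _ h, Finsupp.single_eq_of_ne h, smul_zero, zero_smul]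

theorem vert_smul_vertEmb_self {I : Type u} (a : V) (z : I →₀ k) :
    vert k a • vertEmb k V I a z = vertEmb k V I a z := by
  refine DFinsupp.ext fun i => ?_
  change vert k a * vertEmb k V I a z i = _
  rw [vertEmb_apply, mul_smul_comm, vert_mul_vert_self]

theorem vert_smul_vertEmb_of_ne {I : Type u} {a b : V} (h : b ≠ a) (z : I →₀ k) :
    vert k b • vertEmb k V I a z = 0 := by
  refine DFinsupp.ext fun i => ?_
  change vert k b * vertEmb k V I a z i = _
  rw [vertEmb_apply, mul_smul_comm, vert_mul_vert h, smul_zero]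
  rfl

theorem apply_mem_rad {I : Type u} {x : ⨁ _ : I, RadSqZeroAlgebra k V} (hx : x ∈ rad k V _)
    (i : I) : x i ∈ rad k V (RadSqZeroAlgebra k V) :=
  map_mem_rad (DirectSum.component (RadSqZeroAlgebra k V) I (fun _ => RadSqZeroAlgebra k V) i) hx

/-- A functional on the `a`-part of a projective module with values in a vector space lifts to the
free module on a basis. -/
theorem exists_lift_vertEmb {M : Type u} [AddCommGroup M] [Module (RadSqZeroAlgebra k V) M]
    [Module k M] [IsScalarTower k (RadSqZeroAlgebra k V) M]
    [Module.Projective (RadSqZeroAlgebra k V) M] (a : V) {I : Type u} (θ : M →ₗ[k] (I →₀ k))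
    (hθ : ∀ x, θ (vert k a • x) = θ x) (hrad : ∀ x ∈ rad k V M, θ x = 0) :
    ∃ g : M →ₗ[RadSqZeroAlgebra k V] (⨁ _ : I, RadSqZeroAlgebra k V),
      ∀ x, g x - vertEmb k V I a (θ x) ∈ rad k V _ := by
  let q := (rad k V (⨁ _ : I, RadSqZeroAlgebra k V)).mkQ
  have hzero : ∀ (e : QuiverArrows V) (z : ⨁ _ : I, RadSqZeroAlgebra k V), arr k e • q z = 0 :=
    fun e z => by
      change q (arr k e • z) = 0
      exact (Submodule.Quotient.mk_eq_zero _).2 (arr_smul_mem_rad (k := k) e z)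
  let Θ : M →ₗ[RadSqZeroAlgebra k V] _ :=
    linearMapOfCommute ((q.restrictScalars k) ∘ₗ vertEmb k V I a ∘ₗ θ)
      (fun b x => by
        change q (vertEmb k V I a (θ (vert k b • x))) = q (vert k b • vertEmb k V I a (θ x))
        by_cases h : b = a
        · subst h
          rw [hθ, vert_smul_vertEmb_self]
        · rw [vert_smul_vertEmb_of_ne h, ← hθ, vert_smul_vert_smul_of_ne k (Ne.symm h), map_zero,
            map_zero])
      (fun e x => by
        change q (vertEmb k V I a (θ (arr k e • x))) = arr k e • q (vertEmb k V I a (θ x))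
        rw [hzero, hrad _ (arr_smul_mem_rad e x), map_zero, map_zero])
  obtain ⟨g, hg⟩ := Module.projective_lifting_property q Θ (Submodule.mkQ_surjective _)
  refine ⟨g, fun x => ?_⟩
  rw [← Submodule.Quotient.eq]
  exact LinearMap.congr_fun hg x

variable [∀ a b : V, Finite (a ⟶ b)]

theorem FiniteTopAt.of_successors {M : DiffProj.{u} (RadSqZeroAlgebra k V)} [Module k M.carrier]
    [IsScalarTower k (RadSqZeroAlgebra k V) M.carrier] (hM : M.Minimal)
    (hc : ∀ (L : Type u) (X : L → DiffProj.{u} (RadSqZeroAlgebra k V)) (f : M ⟶ directSum X),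
      FinitelySupported f) (a : V)
    (ih : ∀ b, Nonempty (a ⟶ b) → FiniteTopAt k b M.carrier) : FiniteTopAt k a M.carrier := by
  classical
  have hF : ∀ b, ∃ F : Set M.carrier, F.Finite ∧ (Nonempty (a ⟶ b) → ∀ x : M.carrier,
      vert k b • x ∈ Submodule.span k F ⊔ (rad k V M.carrier).restrictScalars k) := fun b => by
    by_cases h : Nonempty (a ⟶ b)
    · obtain ⟨F, hF, h'⟩ := ih b h
      exact ⟨F, hF, fun _ => h'⟩
    · exact ⟨∅, Set.finite_empty, fun h' => absurd h' h⟩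
  choose F hFfin hF using hF
  choose dec hdec1 hdec2 using fun x => exists_eq_sum_of_mem_rad (hM x)
  -- The coefficients, along arrows starting at `a`, of the differentials of the finitely many
  -- elements in the sets `F b`. Modulo `K` below, exactly the top at `a` divided by their span
  -- remains.
  let G : Set M.carrier :=
    ⋃ e : (Σ b, a ⟶ b), (fun x => dec x ⟨a, e.1, e.2⟩) '' F e.1
  have hG : G.Finite := Set.finite_iUnion fun e => (hFfin e.1).image _
  let va : M.carrier →ₗ[k] M.carrier := Algebra.lsmul k k M.carrier (vert k a)
  let K : Submodule k M.carrier :=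
    (Submodule.span k G ⊔ (rad k V M.carrier).restrictScalars k).comap va
  have hK : ∀ x, x ∈ K ↔
      vert k a • x ∈ Submodule.span k G ⊔ (rad k V M.carrier).restrictScalars k := fun x => Iff.rfl
  have hKrad : ∀ x ∈ rad k V M.carrier, x ∈ K := fun x hx =>
    (hK x).2 (Submodule.mem_sup_right (Submodule.smul_mem (rad k V M.carrier) _ hx))
  have hKne : ∀ {c : V} (x : M.carrier), a ≠ c → vert k c • x = x → x ∈ K := fun {c} x h hx => by
    rw [hK, ← hx, vert_smul_vert_smul_of_ne k h]
    exact zero_mem _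
  let B := Module.Basis.ofVectorSpace k (M.carrier ⧸ K)
  let I := Module.Basis.ofVectorSpaceIndex k (M.carrier ⧸ K)
  let θ : M.carrier →ₗ[k] (I →₀ k) := B.repr.toLinearMap ∘ₗ K.mkQ
  have hθK : ∀ x ∈ K, θ x = 0 := fun x hx => by
    change B.repr (K.mkQ x) = 0
    rw [show K.mkQ x = 0 from (Submodule.Quotient.mk_eq_zero _).2 hx, map_zero]
  -- Only the class of `g` modulo the radical is prescribed; projectivity supplies the lift.
  obtain ⟨g, hg⟩ := exists_lift_vertEmb a θ
    (fun x => by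
      rw [← sub_eq_zero, ← map_sub]
      refine hθK _ ((hK _).2 ?_)
      rw [smul_sub, vert_smul_vert_smul, sub_self]
      exact zero_mem _)
    (fun x hx => hθK x (hKrad x hx))
  have hgK : ∀ x ∈ K, g x ∈ rad k V _ := fun x hx => by
    have := hg x
    rwa [hθK x hx, map_zero, sub_zero] at this
  have hgd0 : ∀ (b : V) (z : M.carrier), (∀ e : a ⟶ b, dec z ⟨a, b, e⟩ ∈ K) →
      g (vert k b • M.d z) = 0 := fun b z hz => by
    rw [hdec2 z, vert_smul_sum_arr, map_sum]
    refine Finset.sum_eq_zero fun e _ => ?_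
    rw [map_smul]
    refine arr_smul_of_mem_rad _ (hgK _ ?_)
    by_cases h : a = e.1
    · obtain ⟨a', e⟩ := e
      subst h
      exact hz e
    · exact hKne _ h (hdec1 z e.arrow)
  have hgd : ∀ x, g (M.d x) = 0 := fun x => by
    rw [← sum_vert_smul (V := V) k (M.d x), map_sum]
    refine Finset.sum_eq_zero fun b _ => ?_
    by_cases hb : Nonempty (a ⟶ b)
    · obtain ⟨f, hf, j, hj, hfj⟩ := Submodule.mem_sup.1 (hF b hb x)
      have h1 : vert k b • M.d x = vert k b • M.d f := by
        have hdj : M.d j = 0 := map_eq_zero_of_mem_rad hM hj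
        rw [← vert_smul_vert_smul, ← map_smul M.d, ← hfj, map_add, hdj, add_zero]
      rw [h1]
      -- The chosen coefficients `dec` need not be linear, but the composite of `d`, the idempotent
      -- at `b` and `g` is, so it suffices to test it on `F b`.
      have h2 : Submodule.span k (F b) ≤ LinearMap.ker
          ((g.restrictScalars k) ∘ₗ (Algebra.lsmul k k M.carrier (vert k b)) ∘ₗ
            (M.d.restrictScalars k)) := by
        refine Submodule.span_le.2 fun z hz => ?_
        refine hgd0 b z fun e => (hK _).2 (Submodule.mem_sup_left ?_)
        rw [hdec1 z ⟨a, b, e⟩]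
        exact Submodule.subset_span (Set.mem_iUnion.2 ⟨⟨b, e⟩, z, hz, rfl⟩)
      exact h2 hf
    · exact hgd0 b x fun e => absurd ⟨e⟩ hb
  let γ : M ⟶ directSum (fun _ : I => trivialDifferential k V) :=
    { lin := g
      comm := by
        refine LinearMap.ext fun x => ?_
        refine (hgd x).trans (DFinsupp.ext fun i => ?_)
        exact (DirectSum.lmap_apply (fun _ : I => (trivialDifferential k V).d) (g x) i).symm }
  obtain ⟨s, φ, r, hr⟩ := hc I _ γ
  -- The target has zero differential, so the homotopy contributes only `r ∘ d`, which is radical by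
  -- minimality.
  have hgs : ∀ (x : M.carrier) (i : I), i ∉ s → g x i ∈ rad k V (RadSqZeroAlgebra k V) := by
    intro x i hi
    have h1 := LinearMap.congr_fun hr x
    rw [sub_lin, LinearMap.sub_apply, sum_lin, LinearMap.sum_apply] at h1
    have h2 : g x i = (∑ l ∈ s, (φ l ≫ inj (fun _ : I => trivialDifferential k V) l).lin x :
        ⨁ _ : I, RadSqZeroAlgebra k V) i + r (M.d x) i + 0 := by
      have h3 := congrArg (fun z : ⨁ _ : I, RadSqZeroAlgebra k V => z i) (sub_eq_iff_eq_add'.1 h1)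
      refine h3.trans ?_
      change _ + (r (M.d x) i + _) = _
      rw [add_assoc]
      congr!
    rw [h2, add_zero, DFinsupp.finsetSum_apply, Finset.sum_eq_zero, zero_add]
    · exact apply_mem_rad (map_mem_rad r (hM x)) i
    · intro l hl
      exact DirectSum.of_eq_of_ne (β := fun _ : I => RadSqZeroAlgebra k V) _ _ _
        (fun h => hi (h ▸ hl))
  -- A lift of the `i`-th basis vector has `i`-th component congruent to the idempotent at `a`,
  -- which is not radical.
  have hI : ∀ i : I, i ∈ s := fun i => by
    by_contra hi
    obtain ⟨x, hx⟩ := K.mkQ_surjective (B i)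
    have h1 := sub_mem (hgs x i hi) (apply_mem_rad (hg x) i)
    have h2 := vertCoeff_of_mem_rad a h1
    have h3 : θ x = Finsupp.single i 1 := by
      change B.repr (K.mkQ x) = _
      rw [hx, B.repr_self]
    rw [DirectSum.sub_apply, sub_sub_cancel, vertEmb_apply, h3] at h2
    simp at h2
  have : Finite I := Finite.of_finite_univ (s.finite_toSet.subset fun i _ => hI i)
  choose w hw using fun i => K.mkQ_surjective (B i)
  refine ⟨G ∪ Set.range fun i => vert k a • w i, hG.union (Set.finite_range _), fun x => ?_⟩
  have := Fintype.ofFinite I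
  have h1 : x - ∑ i, B.repr (K.mkQ x) i • w i ∈ K := by
    rw [← Submodule.Quotient.mk_eq_zero]
    change K.mkQ _ = 0
    rw [map_sub, map_sum, sub_eq_zero]
    simp only [map_smul, hw]
    exact (B.sum_repr _).symm
  rw [← sub_add_cancel x (∑ i, B.repr (K.mkQ x) i • w i), smul_add]
  refine add_mem ?_ (Submodule.mem_sup_left ?_)
  · exact SetLike.le_def.1 (sup_le_sup_right (Submodule.span_mono Set.subset_union_left) _)
      ((hK _).1 h1)
  · change va _ ∈ _
    rw [map_sum]
    refine Submodule.sum_mem _ fun i _ => ?_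
    rw [map_smul]
    exact Submodule.smul_mem _ _ (Submodule.subset_span (Or.inr ⟨i, rfl⟩))

end Step

variable [∀ a b : V, Finite (a ⟶ b)]

/-- Nakayama's argument: if a finite set spans the module modulo the radical, its arrow multiples
span the radical, since arrows kill the radical. -/
theorem finite_of_finiteTopAt {M : Type*} [AddCommGroup M] [Module (RadSqZeroAlgebra k V) M]
    [Module k M] [IsScalarTower k (RadSqZeroAlgebra k V) M]
    (h : ∀ a : V, FiniteTopAt k a M) : Module.Finite k M := by
  choose F hFfin hF using h
  let G : Set M := ⋃ a, F a
  have hG : G.Finite := Set.finite_iUnion hFfin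
  have hspan : ∀ x : M, x ∈ Submodule.span k G ⊔ (rad k V M).restrictScalars k := fun x => by
    rw [← sum_vert_smul (V := V) k x]
    exact Submodule.sum_mem _ fun a _ =>
      SetLike.le_def.1 (sup_le_sup_right (Submodule.span_mono (Set.subset_iUnion F a)) _) (hF a x)
  let H : Set M := ⋃ e : QuiverArrows V, (fun y => arr k e • y) '' G
  have hH : H.Finite := Set.finite_iUnion fun e => hG.image _
  refine ⟨Submodule.fg_def.2 ⟨G ∪ H, hG.union hH, Submodule.eq_top_iff'.2 fun x => ?_⟩⟩
  obtain ⟨f, hf, j, hj, rfl⟩ := Submodule.mem_sup.1 (hspan x)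
  refine add_mem (Submodule.span_mono Set.subset_union_left hf) ?_
  obtain ⟨y, -, rfl⟩ := exists_eq_sum_of_mem_rad (show j ∈ rad k V M from hj)
  refine Submodule.sum_mem _ fun e _ => ?_
  obtain ⟨f, hf, j, hj, hfj⟩ := Submodule.mem_sup.1 (hspan (y e))
  rw [← hfj, smul_add, arr_smul_of_mem_rad e (show j ∈ rad k V M from hj), add_zero]
  exact Submodule.span_mono (Set.subset_union_of_subset_right (Set.subset_iUnion _ e) _)
    (smul_mem_span_image M (arr k e) hf)

theorem finite_of_acyclic (hV : QuiverAcyclic V) {M : DiffProj.{u} (RadSqZeroAlgebra k V)}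
    [Module k M.carrier] [IsScalarTower k (RadSqZeroAlgebra k V) M.carrier] (hM : M.Minimal)
    (hc : ∀ (L : Type u) (X : L → DiffProj.{u} (RadSqZeroAlgebra k V)) (f : M ⟶ directSum X),
      FinitelySupported f) : Module.Finite k M.carrier := by
  -- The smaller vertex is the end of the path, so the induction runs from the sinks backwards;
  -- acyclicity gives irreflexivity, and finiteness of `V` gives well-foundedness.
  let R : V → V → Prop := fun b a => ∃ p : Quiver.Path a b, p.length ≠ 0
  have : IsTrans V R := ⟨fun a b c ⟨p, hp⟩ ⟨q, _⟩ => ⟨q.comp p, by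
    rw [Quiver.Path.length_comp]
    omega⟩⟩
  have : Std.Irrefl R := ⟨fun a ⟨p, hp⟩ => hp (hV a p)⟩
  refine finite_of_finiteTopAt (V := V) fun a => ?_
  induction a using (Finite.wellFounded_of_trans_of_irrefl R).induction with
  | _ a ih =>
    exact FiniteTopAt.of_successors hM hc a fun b ⟨e⟩ => ih b ⟨e.toPath, one_ne_zero⟩

theorem mem_finDimObjects_of_compact (hV : QuiverAcyclic V)
    (M : DiffProjHomotopyCategory.{u} (RadSqZeroAlgebra k V)) (hM : CompactObject.{u} M) :
    finDimObjects.{u} k (RadSqZeroAlgebra k V) M := by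
  obtain ⟨N, P, ⟨e⟩, hN, hP⟩ := exists_contractible_prod_minimal M.as
  refine ⟨P, ⟨hP.reduced, N, hN, ⟨e⟩⟩, ?_⟩
  let _ : Module k P.carrier := Module.compHom P.carrier (algebraMap k (RadSqZeroAlgebra k V))
  have : IsScalarTower k (RadSqZeroAlgebra k V) P.carrier :=
    ⟨fun c r x => by rw [Algebra.smul_def, mul_smul]; rfl⟩
  exact finite_of_acyclic hV hP fun L X f => finitelySupported_of_retract hM
    (prodInr N P ≫ e.inv) (e.hom ≫ prodSnd N P) (by simp [prodInr_snd]) f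

/-- Minimality forces the contractible summand in any decomposition to vanish, so the reduced part
carries all generators, one for each of infinitely many paths. -/
theorem not_mem_finDimObjects_pathModule {v : V} (q : Quiver.Path v v) (hq : q.length ≠ 0) :
    ¬ finDimObjects.{u} k (RadSqZeroAlgebra k V) ⟨pathModule k v⟩ := by
  rintro ⟨P, ⟨-, N, hN, ⟨e⟩⟩, hfin⟩
  have hinf := PathTo.infinite_of_cycle q hq
  have hsub := (pathModule_minimal k v).subsingleton_of_iso e hN
  let _ : Module k P.carrier := Module.compHom P.carrier (algebraMap k (RadSqZeroAlgebra k V))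
  have : IsScalarTower k (RadSqZeroAlgebra k V) P.carrier :=
    ⟨fun c r x => by rw [Algebra.smul_def, mul_smul]; rfl⟩
  have : Module.Finite k P.carrier := hfin
  let f : P.carrier →ₗ[RadSqZeroAlgebra k V]
      ((Σ a : V, PathTo v a) →₀ RadSqZeroAlgebra k V) :=
    (vertFree k _).subtype ∘ₗ (prodInr N P ≫ e.inv).lin
  refine not_finite_iff_infinite.2 hinf
    (finite_of_single_vert_mem_range Sigma.fst (f.restrictScalars k) fun i => ?_)
  refine ⟨(e.hom.lin (gen k Sigma.fst i)).2, ?_⟩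
  have h1 : ((0 : N.carrier), (e.hom.lin (gen k Sigma.fst i)).2) =
      e.hom.lin (gen k Sigma.fst i) := Prod.ext (Subsingleton.elim _ _) rfl
  have h2 := LinearMap.congr_fun (congrArg Hom.lin e.hom_inv_id) (gen k Sigma.fst i)
  have h3 : e.inv.lin ((0 : N.carrier), (e.hom.lin (gen k Sigma.fst i)).2) =
      gen k Sigma.fst i := (congrArg e.inv.lin h1).trans h2
  exact congrArg Subtype.val h3

end DiffProj

end

/-! ### The inclusion and the criterion for equality -/

theorem mainTheorem5 (k : Type u) [Field k] (V : Type u) [Quiver.{u} V] [Fintype V]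
    [∀ a b : V, Finite (a ⟶ b)] :
    finDimObjects.{u} k (RadSqZeroAlgebra k V) ≤ compactObjects.{u} (RadSqZeroAlgebra k V) ∧
      (finDimObjects.{u} k (RadSqZeroAlgebra k V) = compactObjects.{u} (RadSqZeroAlgebra k V) ↔
        QuiverAcyclic V) := by
  have hle : finDimObjects.{u} k (RadSqZeroAlgebra k V) ≤
      compactObjects.{u} (RadSqZeroAlgebra k V) := by
    rintro M ⟨P, ⟨-, N, hN, ⟨e⟩⟩, hfin⟩
    let _ : Module k P.carrier := Module.compHom P.carrier (algebraMap k (RadSqZeroAlgebra k V))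
    have : IsScalarTower k (RadSqZeroAlgebra k V) P.carrier :=
      ⟨fun c r x => by rw [Algebra.smul_def, mul_smul]; rfl⟩
    have : Module.Finite k P.carrier := hfin
    exact DiffProj.compactObject_of_fg e hN
      (Module.Finite.of_restrictScalars_finite k (RadSqZeroAlgebra k V) P.carrier)
  refine ⟨hle, fun h v q => ?_, fun h => le_antisymm hle (DiffProj.mem_finDimObjects_of_compact h)⟩
  by_contra hq
  refine DiffProj.not_mem_finDimObjects_pathModule (k := k) q hq ?_
  rw [h]
  exact DiffProj.pathModule_compact k v
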